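/- Let $\Bbbk$ be a field of characteristic different from $2$, and let $\mathcal B$ be the super Jordan plane: the $\Bbbk$-algebra generated by $x,y$ with defining relations $$x^2=0,\qquad yz-zy-xz=0,\qquad\text{where } z=xy+yx .$$ Give $x$ and $y$ degree $1$; then $\mathcal B=\bigoplus_{n\ge 0}\mathcal B^{(n)}$ is graded and $\mathcal B=\mathcal B_0\oplus\mathcal B_1$ is a superalgebra (a $C_2$-graded algebra), where $\mathcal B_0$ and $\mathcal B_1$ are the sums of the components of even, respectively odd, degree. An element of a ring is called regular if it is neither a left nor a right zero divisor. Let $S_0$ be the set of regular elements of the ring $\mathcal B_0$, and let $S$ be the set of elements of $\mathcal B_0\cup\mathcal B_1$ that are regular in $\mathcal B$. Then: (i) The multiplicative set $S$ satisfies the left and right Ore conditions in $\mathcal B$. In particular the ring of fractions $Q=\mathcal B S^{-1}$ exists. (ii) The algebra $Q$ has a structure of superalgebra $Q=Q_0\oplus Q_1$ such that the canonical map $\mathcal B\to Q$ preserves parity and the even part is $Q_0=\mathcal B_0S_0^{-1}$ (the restriction $\mathcal B_0\to Q_0$ of the canonical map is a ring of fractions of $\mathcal B_0$ with respect to $S_0$).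 Moreover $Q=\mathcal B S_0^{-1}$. (iii) With this grading, $Q$ is super-simple (it is nonzero and its only homogeneous two-sided ideals are $0$ and $Q$) and super-artinian (every descending chain of homogeneous left ideals, and every descending chain of homogeneous right ideals, becomes stationary). -/

import Mathlib

universe u v

/-! ### The super Jordan plane and its parity grading -/

namespace SuperJordan

/-- The free generator `x`. -/
noncomputable abbrev freeX (k : Type*) [Field k] : FreeAlgebra k (Fin 2) := FreeAlgebra.ι k 0

/-- The free generator `y`. -/
noncomputable abbrev freeY (k : Type*) [Field k] : FreeAlgebra k (Fin 2) := FreeAlgebra.ι k 1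

/-- The element `z = x y + y x` of the free algebra. -/
noncomputable abbrev freeZ (k : Type*) [Field k] : FreeAlgebra k (Fin 2) :=
  freeX k * freeY k + freeY k * freeX k

/-- The defining relations `x ^ 2 = 0` and `y z - z y - x z = 0`, the latter written
as `y z = z y + x z`. -/
inductive Rel (k : Type*) [Field k] : FreeAlgebra k (Fin 2) → FreeAlgebra k (Fin 2) → Prop
  | square : Rel k (freeX k ^ 2) 0
  | cubic : Rel k (freeY k * freeZ k) (freeZ k * freeY k + freeX k * freeZ k)

/-- The super Jordan plane: the `k`-algebra generated by `x`, `y` with relations `x ^ 2 = 0` and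
`y z - z y - x z = 0`, where `z = x y + y x`. -/
abbrev Plane (k : Type*) [Field k] : Type _ := RingQuot (Rel k)

/-- The generator `x`. -/
noncomputable def x (k : Type*) [Field k] : Plane k := RingQuot.mkAlgHom k (Rel k) (freeX k)

/-- The generator `y`. -/
noncomputable def y (k : Type*) [Field k] : Plane k := RingQuot.mkAlgHom k (Rel k) (freeY k)

/-- The component of degree `n`, where `x` and `y` have degree `1`: the span of all products of
`n` generators. -/
noncomputable def degreePart (k : Type*) [Field k] (n : ℕ) : Submodule k (Plane k) :=
  Submodule.span k {x k, y k} ^ n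

/-- The even part (`i = 0`) and the odd part (`i = 1`): the sum of the components of even,
respectively odd, degree. -/
noncomputable def parityPart (k : Type*) [Field k] (i : ZMod 2) : Submodule k (Plane k) :=
  ⨆ (n : ℕ) (_ : (n : ZMod 2) = i), degreePart k n

theorem degreePart_le (k : Type*) [Field k] {n : ℕ} {i : ZMod 2} (h : (n : ZMod 2) = i) :
    degreePart k n ≤ parityPart k i :=
  le_iSup₂_of_le n h le_rfl

theorem x_sq (k : Type*) [Field k] : x k * x k = 0 := by
  have h := RingQuot.mkAlgHom_rel k (Rel.square (k := k))
  rwa [map_zero, map_pow, pow_two] at h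

theorem cubic (k : Type*) [Field k] :
    y k * (x k * y k + y k * x k)
      = (x k * y k + y k * x k) * y k + x k * (x k * y k + y k * x k) := by
  have h := RingQuot.mkAlgHom_rel k (Rel.cubic (k := k))
  simp only [map_mul, map_add] at h
  exact h

theorem x_mem (k : Type*) [Field k] : x k ∈ parityPart k 1 :=
  degreePart_le k (n := 1) (by simp) (by
    rw [degreePart, pow_one]; exact Submodule.subset_span (by simp))

theorem y_mem (k : Type*) [Field k] : y k ∈ parityPart k 1 :=
  degreePart_le k (n := 1) (by simp) (by
    rw [degreePart, pow_one]; exact Submodule.subset_span (by simp))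

instance gradedMonoid (k : Type*) [Field k] : SetLike.GradedMonoid (parityPart k) where
  one_mem := degreePart_le k (n := 0) (by simp) (by
    rw [degreePart, pow_zero]; exact Submodule.one_le.mp le_rfl)
  mul_mem := by
    intro i j a b ha hb
    have key : parityPart k i * parityPart k j ≤ parityPart k (i + j) := by
      simp only [parityPart, Submodule.iSup_mul, Submodule.mul_iSup]
      refine iSup₂_le fun n hn => iSup₂_le fun m hm => ?_
      refine le_iSup₂_of_le (m + n) (by push_cast; rw [hm, hn]) ?_
      rw [degreePart, degreePart, degreePart, pow_add]
    exact key (Submodule.mul_mem_mul ha hb)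

open scoped DirectSum in
theorem of_mul_of_eq (k : Type*) [Field k] {i j l : ZMod 2} (h : l = i + j)
    (a : parityPart k i) (b : parityPart k j) :
    DirectSum.of (fun i => ↥(parityPart k i)) i a * DirectSum.of (fun i => ↥(parityPart k i)) j b
      = DirectSum.of (fun i => ↥(parityPart k i)) l
        ⟨(a : Plane k) * b, h ▸ SetLike.mul_mem_graded a.2 b.2⟩ := by
  subst h
  rw [DirectSum.of_mul_of]
  rfl

open scoped DirectSum in
/-- The images of the generators under the decomposition into parity components. -/
noncomputable def freeDecompose (k : Type*) [Field k] :
    FreeAlgebra k (Fin 2) →ₐ[k] ⨁ i, parityPart k i :=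
  FreeAlgebra.lift k
    ![DirectSum.of (fun i => ↥(parityPart k i)) 1 ⟨x k, x_mem k⟩,
      DirectSum.of (fun i => ↥(parityPart k i)) 1 ⟨y k, y_mem k⟩]

theorem freeDecompose_x (k : Type*) [Field k] :
    freeDecompose k (freeX k)
      = DirectSum.of (fun i => ↥(parityPart k i)) 1 ⟨x k, x_mem k⟩ := by
  rw [freeDecompose, FreeAlgebra.lift_ι_apply]; rfl

theorem freeDecompose_y (k : Type*) [Field k] :
    freeDecompose k (freeY k)
      = DirectSum.of (fun i => ↥(parityPart k i)) 1 ⟨y k, y_mem k⟩ := by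
  rw [freeDecompose, FreeAlgebra.lift_ι_apply]; rfl

theorem freeDecompose_rel (k : Type*) [Field k] ⦃a b : FreeAlgebra k (Fin 2)⦄ (h : Rel k a b) :
    freeDecompose k a = freeDecompose k b := by
  have h0 : (0 : ZMod 2) = 1 + 1 := by decide
  have h1 : (1 : ZMod 2) = 1 + 0 := by decide
  have h2 : (1 : ZMod 2) = 0 + 1 := by decide
  cases h with
  | square =>
    rw [pow_two, map_mul, map_zero, freeDecompose_x, of_mul_of_eq k h0,
      ← map_zero (DirectSum.of (fun i => ↥(parityPart k i)) 0)]
    congr 1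
    exact Subtype.ext (x_sq k)
  | cubic =>
    simp only [map_mul, map_add]
    rw [freeDecompose_x, freeDecompose_y, of_mul_of_eq k h0, of_mul_of_eq k h0, ← map_add,
      of_mul_of_eq k h1, of_mul_of_eq k h2, of_mul_of_eq k h1, ← map_add]
    congr 1
    exact Subtype.ext (cubic k)

open scoped DirectSum in
/-- The decomposition into parity components. -/
noncomputable def decomposeHom (k : Type*) [Field k] : Plane k →ₐ[k] ⨁ i, parityPart k i :=
  RingQuot.liftAlgHom k ⟨freeDecompose k, freeDecompose_rel k⟩

theorem decomposeHom_x (k : Type*) [Field k] :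
    decomposeHom k (x k) = DirectSum.of (fun i => ↥(parityPart k i)) 1 ⟨x k, x_mem k⟩ := by
  simp [decomposeHom, x, freeDecompose]

theorem decomposeHom_y (k : Type*) [Field k] :
    decomposeHom k (y k) = DirectSum.of (fun i => ↥(parityPart k i)) 1 ⟨y k, y_mem k⟩ := by
  simp [decomposeHom, y, freeDecompose]

theorem decomposeHom_of_mem_span (k : Type*) [Field k] {a : Plane k}
    (ha : a ∈ Submodule.span k {x k, y k}) (ha' : a ∈ parityPart k 1) :
    decomposeHom k a = DirectSum.of (fun i => ↥(parityPart k i)) 1 ⟨a, ha'⟩ := by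
  obtain ⟨c, d, rfl⟩ := Submodule.mem_span_pair.mp ha
  rw [map_add, map_smul, map_smul, decomposeHom_x, decomposeHom_y]
  simp only [← DirectSum.lof_eq_of k]
  rw [← map_smul, ← map_smul, ← map_add]
  rfl

theorem decomposeHom_of_mem_degreePart (k : Type*) [Field k] (n : ℕ) {a : Plane k}
    (ha : a ∈ degreePart k n) :
    decomposeHom k a
      = DirectSum.of (fun i => ↥(parityPart k i)) (n : ZMod 2) ⟨a, degreePart_le k rfl ha⟩ := by
  unfold degreePart at ha
  induction ha using Submodule.pow_induction_on_left' with
  | algebraMap r =>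
    rw [AlgHom.commutes, DirectSum.algebraMap_apply]
    exact DirectSum.of_eq_of_gradedMonoid_eq (Sigma.subtype_ext Nat.cast_zero.symm rfl)
  | add a b n ha hb iha ihb =>
    rw [map_add, iha, ihb, ← map_add]
    rfl
  | mem_mul m hm n a ha ih =>
    have hm' : m ∈ parityPart k 1 :=
      degreePart_le k (n := 1) (by simp) (by rwa [degreePart, pow_one])
    rw [map_mul, ih, decomposeHom_of_mem_span k hm hm',
      of_mul_of_eq k (l := ((n + 1 : ℕ) : ZMod 2)) (by push_cast; ring)]

/-- The super Jordan plane is a superalgebra. -/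
noncomputable instance gradedAlgebra (k : Type*) [Field k] : GradedAlgebra (parityPart k) :=
  GradedAlgebra.ofAlgHom (parityPart k) (decomposeHom k)
    (by
      refine RingQuot.ringQuot_ext' k _ _ (FreeAlgebra.hom_ext (funext fun i => ?_))
      fin_cases i
      · change DirectSum.coeAlgHom (parityPart k) (decomposeHom k (x k)) = x k
        rw [decomposeHom_x, DirectSum.coeAlgHom_of]
      · change DirectSum.coeAlgHom (parityPart k) (decomposeHom k (y k)) = y k
        rw [decomposeHom_y, DirectSum.coeAlgHom_of])
    (by
      rintro i ⟨a, ha⟩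
      have key : ∃ hb : a ∈ parityPart k i,
          decomposeHom k a = DirectSum.of (fun i => ↥(parityPart k i)) i ⟨a, hb⟩ := by
        have ha' := ha
        clear ha
        rw [parityPart, iSup_subtype'] at ha'
        induction ha' using Submodule.iSup_induction' with
        | mem n b hb =>
          obtain ⟨n, rfl⟩ := n
          exact ⟨_, decomposeHom_of_mem_degreePart k n hb⟩
        | zero => exact ⟨zero_mem _, by rw [map_zero]; exact (map_zero _).symm⟩
        | add b c _ _ hb hc =>
          obtain ⟨hb, eb⟩ := hb
          obtain ⟨hc, ec⟩ := hc
          exact ⟨add_mem hb hc, by rw [map_add, eb, ec, ← map_add]; rfl⟩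
      exact key.2)

/-- The even part `B_0`, as a subalgebra of the super Jordan plane. -/
noncomputable abbrev evenPart (k : Type*) [Field k] : Subalgebra k (Plane k) :=
  SetLike.GradeZero.subalgebra (parityPart k)

/-- The set `S` of homogeneous regular elements of the super Jordan plane `B`
(regular: neither a left nor a right zero divisor). -/
noncomputable def S (k : Type*) [Field k] : Submonoid (Plane k) :=
  SetLike.homogeneousSubmonoid (parityPart k) ⊓ nonZeroDivisors (Plane k)

/-- The set `S_0` of regular elements of the ring `B_0`. -/
noncomputable def S₀ (k : Type*) [Field k] : Submonoid (evenPart k) :=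
  nonZeroDivisors (evenPart k)

end SuperJordan

/-! ### Rings of fractions -/

/-- The left Ore condition for `S` in `R`: `S r ∩ R s ≠ ∅` for all `r ∈ R`, `s ∈ S`. -/
def LeftOreCondition {R : Type*} [Ring R] (S : Submonoid R) : Prop :=
  ∀ r : R, ∀ s ∈ S, ∃ r' : R, ∃ s' ∈ S, s' * r = r' * s

/-- The right Ore condition for `S` in `R`: `r S ∩ s R ≠ ∅` for all `r ∈ R`, `s ∈ S`. -/
def RightOreCondition {R : Type*} [Ring R] (S : Submonoid R) : Prop :=
  ∀ r : R, ∀ s ∈ S, ∃ r' : R, ∃ s' ∈ S, r * s' = s * r'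

/-- `f : R → Q` exhibits `Q` as the right ring of fractions `R S⁻¹`: the elements of `S` become
invertible, every element of `Q` has the form `f r * (f s)⁻¹` with `s ∈ S`, and the kernel of `f`
consists of the elements that are annihilated on the right by an element of `S`. -/
structure IsRightRingOfFractions {R Q : Type*} [Ring R] [Ring Q] (S : Submonoid R)
    (f : R →+* Q) : Prop where
  isUnit : ∀ s ∈ S, IsUnit (f s)
  exists_fraction : ∀ q : Q, ∃ r : R, ∃ s ∈ S, q * f s = f r
  map_eq_zero_iff : ∀ r : R, f r = 0 ↔ ∃ s ∈ S, r * s = 0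

/-! ### Super-simple and super-artinian superalgebras -/

/-- A superalgebra is super-simple if it is nonzero and has no homogeneous two-sided ideals other
than `0` and the whole algebra. -/
def IsSuperSimple {k A : Type*} [Field k] [Ring A] [Algebra k A] (𝒜 : ZMod 2 → Submodule k A)
    [GradedAlgebra 𝒜] : Prop :=
  Nontrivial A ∧ ∀ I : Ideal A, I.IsTwoSided → I.IsHomogeneous 𝒜 → I = ⊥ ∨ I = ⊤

/-- A superalgebra is super-artinian if every descending chain of homogeneous left ideals, and every
descending chain of homogeneous right ideals, becomes stationary. -/
def IsSuperArtinian {k A : Type*} [Field k] [Ring A] [Algebra k A] (𝒜 : ZMod 2 → Submodule k A)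
    [GradedAlgebra 𝒜] : Prop :=
  (∀ I : ℕ → Submodule A A, Antitone I → (∀ n, (I n).IsHomogeneous 𝒜) →
    ∃ N, ∀ n, N ≤ n → I n = I N) ∧
  (∀ I : ℕ → Submodule Aᵐᵒᵖ A, Antitone I → (∀ n, (I n).IsHomogeneous 𝒜) →
    ∃ N, ∀ n, N ≤ n → I n = I N)

/-!
The super Jordan plane `B` contains the Jordan plane `J`, generated by `z` and `t = y ^ 2` with
`t z - z t = z ^ 2`. Everything rests on the fact that the nonzero elements of `J` are regular in
`B` and suffice as denominators.

*Regularity.* `B` acts on pairs `(f, g)` of polynomials in `y` and `z`, which stand for the normal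
forms `f + x g`. This gives the PBW basis `z ^ b y ^ c`, `x z ^ b y ^ c`. A nonzero element of `J`
multiplies the lowest `z`-coefficient of a normal form by a nonzero polynomial in `y`, up to a
shift, so it is left regular; the anti-automorphism `x ↦ -x`, `y ↦ y` preserves `J` and turns left
into right (`jordan_mem_nonZeroDivisors`).

*Ore conditions.* `B` and `J` both grow quadratically. If `s` is left regular, then `s B` leaves
only a linearly growing number of dimensions uncovered, so for each `r` some `r j` with
`0 ≠ j ∈ J` lies in `s B` (`exists_jordan_mul_eq_mul`). Hence in any ring of fractions `Q` the
denominators can be taken in `J`. As `J` is even, the fractions with even, respectively odd,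
numerator form the two components of a grading of `Q` (`fractionGradedAlgebra`). An even element
that is regular in `B_0` is regular in `B`, because multiplication by the regular element `y` moves
odd elements into `B_0` (`coe_mem_nonZeroDivisors`).

*Structure of `Q`.* The element `e = z⁻¹ x y` is a central idempotent of `Q_0`. Since
`B_0 = J + x y J`, multiplication by `e` or by `1 - e` sends each even element of `B` into the
multiples of `J`, so `e Q_0` and `(1 - e) Q_0` are division rings. Moreover `y e = (1 - e) y`, so
the unit `y` interchanges them (`exists_idempotents`). A homogeneous one-sided ideal is determined
by its even part, because `y` is an odd unit, and hence by which of `e` and `1 - e` it contains. A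
homogeneous two-sided ideal contains both or none.
-/

/-! ### Relations and universal property -/

/-- The defining relations of the super Jordan plane, for elements `x`, `y` of a ring and
`z = x y + y x`, the latter equation written as a rule for `y x`. -/
structure SuperJordanRelations {A : Type*} [Ring A] (x y z : A) : Prop where
  x_mul_x : x * x = 0
  y_mul_x : y * x = z - x * y
  y_mul_z : y * z = z * y + x * z

/-- The algebra `A` is the super Jordan plane with generators `x`, `y` and `z = x y + y x`: the
relations hold, `x` and `y` generate `A`, and every pair satisfying the relations in an algebra of
the same universe is the image of `x`, `y`. Working with this characterization instead of the
concrete quotient keeps the ring structure of `A` opaque. -/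
structure IsSuperJordanPlane (k : Type u) [Field k] {A : Type u} [Ring A] [Algebra k A]
    (x y z : A) : Prop extends SuperJordanRelations x y z where
  adjoin_eq_top : Algebra.adjoin k {x, y} = ⊤
  exists_lift : ∀ {C : Type u} [Ring C] [Algebra k C] {X Y Z : C}, SuperJordanRelations X Y Z →
    ∃ f : A →ₐ[k] C, f x = X ∧ f y = Y

namespace SuperJordan

theorem adjoin_x_y (k : Type*) [Field k] : Algebra.adjoin k {x k, y k} = ⊤ := by
  have h : (RingQuot.mkAlgHom k (Rel k)).range = ⊤ :=
    AlgHom.range_eq_top _ |>.mpr (RingQuot.mkAlgHom_surjective k (Rel k))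
  rw [← h, ← Algebra.map_top, ← FreeAlgebra.adjoin_range_ι, AlgHom.map_adjoin]
  congr 1
  ext a
  simp only [Set.mem_insert_iff, Set.mem_singleton_iff, Set.mem_image, Set.mem_range]
  constructor
  · rintro (rfl | rfl)
    · exact ⟨_, ⟨0, rfl⟩, rfl⟩
    · exact ⟨_, ⟨1, rfl⟩, rfl⟩
  · rintro ⟨_, ⟨i, rfl⟩, rfl⟩
    fin_cases i
    · exact Or.inl rfl
    · exact Or.inr rfl

theorem isSuperJordanPlane (k : Type u) [Field k] :
    IsSuperJordanPlane k (x k) (y k) (x k * y k + y k * x k) where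
  x_mul_x := x_sq k
  y_mul_x := (add_sub_cancel_left (x k * y k) (y k * x k)).symm
  y_mul_z := cubic k
  adjoin_eq_top := adjoin_x_y k
  exists_lift := by
    intro C _ _ X Y Z h
    have hZ : X * Y + Y * X = Z := by rw [h.y_mul_x]; abel
    refine ⟨RingQuot.liftAlgHom k ⟨FreeAlgebra.lift k ![X, Y], ?_⟩, ?_, ?_⟩
    · intro a b hab
      cases hab with
      | square => simp [pow_two, h.x_mul_x]
      | cubic => simp [hZ, h.y_mul_z]
    · simp [x]
    · simp [y]

end SuperJordan

/-! ### Commutation relations -/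

namespace SuperJordanRelations

variable {A : Type*} [Ring A] {x y z : A} (h : SuperJordanRelations x y z)
include h

theorem x_mul_z : x * z = z * x := by
  have hz : z = x * y + y * x := by rw [h.y_mul_x]; abel
  rw [hz, mul_add, add_mul, ← mul_assoc, h.x_mul_x, zero_mul, zero_add, mul_assoc y, h.x_mul_x,
    mul_zero, add_zero, mul_assoc]

theorem x_mul_z_pow (n : ℕ) : x * z ^ n = z ^ n * x :=
  ((show Commute x z from h.x_mul_z).pow_right n).eq

theorem y_mul_z_pow (n : ℕ) : y * z ^ n = z ^ n * y + n • (x * z ^ n) := by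
  induction n with
  | zero => simp
  | succ n ih =>
    rw [pow_succ, ← mul_assoc, ih, add_mul, mul_assoc, h.y_mul_z, mul_add, ← mul_assoc,
      ← mul_assoc, ← h.x_mul_z_pow, mul_assoc x, smul_mul_assoc, mul_assoc x, add_smul, one_smul]
    abel

theorem xy_mul_z : x * y * z = z * (x * y) := by
  rw [mul_assoc, h.y_mul_z, mul_add, ← mul_assoc x x, h.x_mul_x, zero_mul, add_zero, ← mul_assoc,
    h.x_mul_z, mul_assoc]

theorem xy_mul_xy : x * y * (x * y) = z * (x * y) := by
  rw [mul_assoc, ← mul_assoc y, h.y_mul_x, sub_mul, mul_sub, mul_assoc x y, ← mul_assoc x x,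
    h.x_mul_x, zero_mul, sub_zero, ← mul_assoc, h.x_mul_z, mul_assoc]

/-- `z` and `y ^ 2` satisfy the defining relation of the Jordan plane. -/
theorem y_sq_mul_z : y ^ 2 * z = z * y ^ 2 + z ^ 2 := by
  rw [pow_two, mul_assoc, h.y_mul_z, mul_add, ← mul_assoc, h.y_mul_z, ← mul_assoc y x, h.y_mul_x,
    sub_mul, h.xy_mul_z, add_mul, h.x_mul_z]
  noncomm_ring

theorem y_sq_mul_xy : y ^ 2 * (x * y) = x * y * y ^ 2 + z * (x * y) := by
  have h1 : y ^ 2 * (x * y) = y * (y * x) * y := by noncomm_ring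
  have h2 : z * (x * y) = x * z * y := by rw [h.x_mul_z, mul_assoc]
  have h3 : y * (x * y) = z * y - x * y * y := by rw [← mul_assoc, h.y_mul_x, sub_mul]
  rw [h1, h2, h.y_mul_x, mul_sub, h.y_mul_z, h3]
  noncomm_ring

theorem y_sq_mul_z_pow (n : ℕ) : y ^ 2 * z ^ n = z ^ n * y ^ 2 + n • z ^ (n + 1) := by
  induction n with
  | zero => simp
  | succ n ih =>
    rw [pow_succ z n, ← mul_assoc, ih, add_mul, mul_assoc, h.y_sq_mul_z, mul_add, ← mul_assoc,
      smul_mul_assoc, ← pow_succ, ← pow_succ, ← pow_add, add_smul, one_smul]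
    abel

end SuperJordanRelations

/-! ### The regular representation and the PBW basis -/

namespace SuperJordan

open Polynomial

section Representation

variable (k : Type*) [Field k]

/-- The basis `z ^ b y ^ c`, indexed by `(c, b)`, of the polynomial ring `k[y][z]`. -/
noncomputable def polyBasis : Module.Basis (ℕ × ℕ) k k[X][X] :=
  (basisMonomials k).smulTower (basisMonomials k[X])

theorem polyBasis_apply (p : ℕ × ℕ) : polyBasis k p = X ^ p.2 * C X ^ p.1 := by
  rw [polyBasis, Module.Basis.smulTower_apply, coe_basisMonomials, coe_basisMonomials,
    smul_monomial, smul_eq_mul, mul_one, ← C_mul_X_pow_eq_monomial, X_pow_mul, ← C_pow]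
  simp only [monomial_one_right_eq_X_pow]

/-- Left multiplication by `x` on normal forms: the pair `(f, g)` stands for `f + x g`, where
`f` and `g` are combinations of the monomials `z ^ b y ^ c`. -/
noncomputable def repX : Module.End k (k[X][X] × k[X][X]) :=
  LinearMap.inr k _ _ ∘ₗ LinearMap.fst k _ _

/-- Left multiplication by `y` on normal forms: since `y z ^ b = z ^ b y + b x z ^ b` and
`y x = z - x y`, one has `y (f + x g) = (y f + z g) + x (z ∂f - y g)` with `∂ = ∂/∂z`. -/
noncomputable def repY : Module.End k (k[X][X] × k[X][X]) where
  toFun v := (C X * v.1 + X * v.2, X * derivative v.1 - C X * v.2)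
  map_add' v w := by ext1 <;> simp <;> ring
  map_smul' c v := by
    ext1
    · simp
    · simp [smul_sub]

@[simp] theorem repX_apply (v : k[X][X] × k[X][X]) : repX k v = (0, v.1) := rfl

@[simp] theorem repY_apply (v : k[X][X] × k[X][X]) :
    repY k v = (C X * v.1 + X * v.2, X * derivative v.1 - C X * v.2) := rfl

/-- Multiplication by `z` on normal forms. -/
noncomputable def repZ : Module.End k (k[X][X] × k[X][X]) where
  toFun v := (X * v.1, X * v.2)
  map_add' v w := by ext1 <;> simp <;> ring
  map_smul' c v := by ext1 <;> simp

@[simp] theorem repZ_apply (v : k[X][X] × k[X][X]) : repZ k v = (X * v.1, X * v.2) := rfl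

theorem rep_relations : SuperJordanRelations (repX k) (repY k) (repZ k) where
  x_mul_x := by refine LinearMap.ext fun v => ?_; simp
  y_mul_x := by refine LinearMap.ext fun v => ?_; simp
  y_mul_z := by
    refine LinearMap.ext fun v => ?_
    simp only [Module.End.mul_apply, LinearMap.add_apply, repX_apply, repY_apply, repZ_apply,
      Prod.mk_add_mk, derivative_mul, derivative_X, Prod.mk.injEq]
    constructor <;> ring

theorem repZ_pow_apply (n : ℕ) (v : k[X][X] × k[X][X]) :
    (repZ k ^ n) v = (X ^ n * v.1, X ^ n * v.2) := by
  induction n with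
  | zero => simp
  | succ n ih => rw [pow_succ', Module.End.mul_apply, ih, repZ_apply, pow_succ']; simp [mul_assoc]

theorem repY_pow_apply_one (n : ℕ) :
    (repY k ^ n) ((1, 0) : k[X][X] × k[X][X]) = (C X ^ n, 0) := by
  induction n with
  | zero => simp
  | succ n ih =>
    rw [pow_succ', Module.End.mul_apply, ih, repY_apply, ← C_pow, derivative_C, pow_succ']
    simp

theorem repY_sq_apply (v : k[X][X] × k[X][X]) :
    (repY k ^ 2) v = (C X ^ 2 * v.1 + X ^ 2 * derivative v.1,
      C X ^ 2 * v.2 + X ^ 2 * derivative v.2 + X * v.2) := by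
  simp only [pow_two, Module.End.mul_apply, repY_apply, derivative_mul, derivative_add,
    derivative_X, derivative_C, Prod.mk.injEq]
  constructor <;> ring

end Representation

/-- The PBW monomials `z ^ b y ^ c` (left summand) and `x z ^ b y ^ c` (right summand), indexed by
`(c, b)`. -/
def pbw {A : Type*} [Ring A] (x y z : A) : (ℕ × ℕ) ⊕ (ℕ × ℕ) → A :=
  Sum.elim (fun p => z ^ p.2 * y ^ p.1) (fun p => x * (z ^ p.2 * y ^ p.1))

/-- The span of the PBW monomials in which both exponents are less than `n`. -/
def box (k : Type*) [Field k] {A : Type*} [Ring A] [Algebra k A] (x y z : A) (n : ℕ) :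
    Submodule k A :=
  Submodule.span k (Set.range fun i : (Fin n × Fin n) ⊕ (Fin n × Fin n) =>
    pbw x y z (i.map (Prod.map Fin.val Fin.val) (Prod.map Fin.val Fin.val)))

section box

variable (k : Type*) [Field k] {A : Type*} [Ring A] [Algebra k A] (x y z : A)

instance (n : ℕ) : FiniteDimensional k (box k x y z n) :=
  FiniteDimensional.span_of_finite k (Set.finite_range _)

variable {n : ℕ} {b c : ℕ}

theorem mem_box_left (hb : b < n) (hc : c < n) : z ^ b * y ^ c ∈ box k x y z n :=
  Submodule.subset_span ⟨Sum.inl (⟨c, hc⟩, ⟨b, hb⟩), rfl⟩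

theorem mem_box_right (hb : b < n) (hc : c < n) : x * (z ^ b * y ^ c) ∈ box k x y z n :=
  Submodule.subset_span ⟨Sum.inr (⟨c, hc⟩, ⟨b, hb⟩), rfl⟩

/-- To control a linear map on a box it suffices to control it on PBW monomials. -/
theorem box_le_comap {W : Submodule k A} (f : A →ₗ[k] A)
    (h₁ : ∀ b < n, ∀ c < n, f (z ^ b * y ^ c) ∈ W)
    (h₂ : ∀ b < n, ∀ c < n, f (x * (z ^ b * y ^ c)) ∈ W) {a : A} (ha : a ∈ box k x y z n) :
    f a ∈ W := by
  suffices box k x y z n ≤ W.comap f from this ha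
  refine Submodule.span_le.mpr ?_
  rintro _ ⟨⟨c, b⟩ | ⟨c, b⟩, rfl⟩
  · exact h₁ b b.2 c c.2
  · exact h₂ b b.2 c c.2

theorem box_mono {m : ℕ} (h : n ≤ m) : box k x y z n ≤ box k x y z m := fun _ ha =>
  box_le_comap k x y z LinearMap.id
    (fun _ hb _ hc => mem_box_left k x y z (hb.trans_le h) (hc.trans_le h))
    (fun _ hb _ hc => mem_box_right k x y z (hb.trans_le h) (hc.trans_le h)) ha

end box

end SuperJordan

namespace SuperJordanRelations

open SuperJordan

variable {k : Type*} [Field k] {A : Type*} [Ring A] [Algebra k A] {x y z : A}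

theorem x_mul_mem_box (h : SuperJordanRelations x y z) {n : ℕ} {a : A} (ha : a ∈ box k x y z n) :
    x * a ∈ box k x y z (n + 1) := by
  refine box_le_comap k x y z (LinearMap.mulLeft k x) (fun b hb c hc => ?_) (fun b hb c hc => ?_) ha
  · exact mem_box_right k x y z (by omega) (by omega)
  · rw [LinearMap.mulLeft_apply, ← mul_assoc, h.x_mul_x, zero_mul]
    exact zero_mem _

theorem y_mul_monomial (h : SuperJordanRelations x y z) (b c : ℕ) :
    y * (z ^ b * y ^ c) = z ^ b * y ^ (c + 1) + b • (x * (z ^ b * y ^ c)) := by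
  rw [← mul_assoc, h.y_mul_z_pow, add_mul, mul_assoc, ← pow_succ', smul_mul_assoc, mul_assoc]

theorem y_mul_mem_box (h : SuperJordanRelations x y z) {n : ℕ} {a : A} (ha : a ∈ box k x y z n) :
    y * a ∈ box k x y z (n + 1) := by
  refine box_le_comap k x y z (LinearMap.mulLeft k y) (fun b hb c hc => ?_) (fun b hb c hc => ?_) ha
  · rw [LinearMap.mulLeft_apply, h.y_mul_monomial]
    exact add_mem (mem_box_left k x y z (by omega) (by omega))
      (nsmul_mem (mem_box_right k x y z (by omega) (by omega)) _)
  · have e : y * (x * (z ^ b * y ^ c)) = z ^ (b + 1) * y ^ c - x * (z ^ b * y ^ (c + 1)) := by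
      rw [← mul_assoc, h.y_mul_x, sub_mul, mul_assoc x, h.y_mul_monomial, mul_add, mul_smul_comm,
        ← mul_assoc x x, h.x_mul_x, zero_mul, smul_zero, add_zero, ← mul_assoc, ← pow_succ']
    rw [LinearMap.mulLeft_apply, e]
    exact sub_mem (mem_box_left k x y z (by omega) (by omega))
      (mem_box_right k x y z (by omega) (by omega))

end SuperJordanRelations

namespace IsSuperJordanPlane

open SuperJordan Polynomial

variable {k : Type u} [Field k] {A : Type u} [Ring A] [Algebra k A] {x y z : A}

@[elab_as_elim]
theorem induction (h : IsSuperJordanPlane k x y z) {p : A → Prop} (hx : p x) (hy : p y)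
    (hs : ∀ r : k, p (algebraMap k A r)) (hadd : ∀ a b, p a → p b → p (a + b))
    (hmul : ∀ a b, p a → p b → p (a * b)) (a : A) : p a := by
  have ha : a ∈ Algebra.adjoin k {x, y} := h.adjoin_eq_top ▸ Algebra.mem_top
  induction ha using Algebra.adjoin_induction with
  | mem a ha => rcases ha with rfl | rfl <;> assumption
  | algebraMap r => exact hs r
  | add a b _ _ iha ihb => exact hadd a b iha ihb
  | mul a b _ _ iha ihb => exact hmul a b iha ihb

/-- Left multiplication by a fixed element enlarges the boxes by a bounded amount. -/
theorem exists_mul_mem_box (h : IsSuperJordanPlane k x y z) (a : A) :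
    ∃ d, ∀ n, ∀ u ∈ box k x y z n, a * u ∈ box k x y z (n + d) := by
  induction a using h.induction with
  | hx => exact ⟨1, fun n u hu => h.x_mul_mem_box hu⟩
  | hy => exact ⟨1, fun n u hu => h.y_mul_mem_box hu⟩
  | hs r => exact ⟨0, fun n u hu => by rw [← Algebra.smul_def]; exact Submodule.smul_mem _ _ hu⟩
  | hadd a b iha ihb =>
    obtain ⟨d, hd⟩ := iha
    obtain ⟨e, he⟩ := ihb
    refine ⟨d + e, fun n u hu => ?_⟩
    rw [add_mul]
    exact add_mem (box_mono k x y z (by omega) (hd n u hu))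
      (box_mono k x y z (by omega) (he n u hu))
  | hmul a b iha ihb =>
    obtain ⟨d, hd⟩ := iha
    obtain ⟨e, he⟩ := ihb
    refine ⟨e + d, fun n u hu => ?_⟩
    rw [mul_assoc, ← add_assoc]
    exact hd _ _ (he n u hu)

theorem exists_mem_box (h : IsSuperJordanPlane k x y z) (a : A) : ∃ n, a ∈ box k x y z n := by
  obtain ⟨d, hd⟩ := h.exists_mul_mem_box a
  refine ⟨1 + d, ?_⟩
  have := hd 1 1 (by simpa using mem_box_left k x y z (b := 0) (c := 0) one_pos one_pos)
  rwa [mul_one] at this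

/-- A linear statement holds on the whole plane if it holds for the PBW monomials. -/
theorem mem_of_pbw_mem (h : IsSuperJordanPlane k x y z) {W : Submodule k A} (f : A →ₗ[k] A)
    (h₁ : ∀ b c, f (z ^ b * y ^ c) ∈ W) (h₂ : ∀ b c, f (x * (z ^ b * y ^ c)) ∈ W) (a : A) :
    f a ∈ W := by
  obtain ⟨n, hn⟩ := h.exists_mem_box a
  exact box_le_comap k x y z f (fun b _ c _ => h₁ b c) (fun b _ c _ => h₂ b c) hn

theorem exists_rep (h : IsSuperJordanPlane k x y z) :
    ∃ ρ : A →ₐ[k] Module.End k (k[X][X] × k[X][X]), ρ x = repX k ∧ ρ y = repY k ∧ ρ z = repZ k := by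
  obtain ⟨ρ, hx, hy⟩ := h.exists_lift (rep_relations k)
  refine ⟨ρ, hx, hy, ?_⟩
  have hz : z = x * y + y * x := by rw [h.y_mul_x]; abel
  rw [hz, map_add, map_mul, map_mul, hx, hy, (rep_relations k).y_mul_x]
  abel

/-- The action of the plane on normal forms. -/
noncomputable def rep (h : IsSuperJordanPlane k x y z) :
    A →ₐ[k] Module.End k (k[X][X] × k[X][X]) := h.exists_rep.choose

theorem rep_x (h : IsSuperJordanPlane k x y z) : h.rep x = repX k := h.exists_rep.choose_spec.1
theorem rep_y (h : IsSuperJordanPlane k x y z) : h.rep y = repY k := h.exists_rep.choose_spec.2.1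
theorem rep_z (h : IsSuperJordanPlane k x y z) : h.rep z = repZ k := h.exists_rep.choose_spec.2.2

theorem rep_pbw (h : IsSuperJordanPlane k x y z) (i : (ℕ × ℕ) ⊕ (ℕ × ℕ)) :
    h.rep (pbw x y z i) (1, 0) = (polyBasis k).prod (polyBasis k) i := by
  rcases i with ⟨c, b⟩ | ⟨c, b⟩
  · rw [Module.Basis.prod_apply, Sum.elim_inl, Function.comp_apply, polyBasis_apply]
    simp only [pbw, Sum.elim_inl, map_mul, map_pow, rep_z, rep_y, Module.End.mul_apply,
      repY_pow_apply_one, repZ_pow_apply, mul_zero, LinearMap.inl_apply]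
  · rw [Module.Basis.prod_apply, Sum.elim_inr, Function.comp_apply, polyBasis_apply]
    simp only [pbw, Sum.elim_inr, map_mul, map_pow, rep_x, rep_z, rep_y, Module.End.mul_apply,
      repY_pow_apply_one, repZ_pow_apply, LinearMap.inr_apply, repX_apply]

theorem linearIndependent_pbw (h : IsSuperJordanPlane k x y z) :
    LinearIndependent k (pbw x y z) := by
  refine LinearIndependent.of_comp ((LinearMap.applyₗ (R := k) (1, 0)) ∘ₗ h.rep.toLinearMap) ?_
  convert ((polyBasis k).prod (polyBasis k)).linearIndependent using 1
  exact funext h.rep_pbw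

/-- An element is determined by its normal form, that is by its action on `1`. -/
theorem eq_zero_of_rep_eq_zero (h : IsSuperJordanPlane k x y z) {a : A}
    (ha : h.rep a (1, 0) = 0) : a = 0 := by
  let N : (k[X][X] × k[X][X]) →ₗ[k] A := ((polyBasis k).prod (polyBasis k)).constr k (pbw x y z)
  have key : ∀ i, N (h.rep (pbw x y z i) (1, 0)) = pbw x y z i := fun i => by
    rw [h.rep_pbw]; exact Module.Basis.constr_basis _ _ _ i
  have := h.mem_of_pbw_mem (W := ⊥)
    (N ∘ₗ (LinearMap.applyₗ (R := k) (1, 0)) ∘ₗ h.rep.toLinearMap - LinearMap.id)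
    (fun b c => (Submodule.mem_bot k).mpr (sub_eq_zero.mpr (key (Sum.inl (c, b)))))
    (fun b c => (Submodule.mem_bot k).mpr (sub_eq_zero.mpr (key (Sum.inr (c, b))))) a
  have e : N (h.rep a (1, 0)) = a := sub_eq_zero.mp ((Submodule.mem_bot k).mp this)
  rw [← e, ha, map_zero]

theorem nontrivial (h : IsSuperJordanPlane k x y z) : Nontrivial A :=
  ⟨_, _, h.linearIndependent_pbw.ne_zero (Sum.inl (0, 0))⟩

theorem finrank_box (h : IsSuperJordanPlane k x y z) (n : ℕ) :
    Module.finrank k (box k x y z n) = 2 * (n * n) := by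
  rw [box, finrank_span_eq_card]
  · simp [two_mul]
  · exact h.linearIndependent_pbw.comp _
      (Sum.map_injective.mpr ⟨Fin.val_injective.prodMap Fin.val_injective,
        Fin.val_injective.prodMap Fin.val_injective⟩)

end IsSuperJordanPlane

/-! ### The Jordan subalgebra -/

namespace SuperJordan

/-- The subalgebra generated by `z` and `y ^ 2`, which is a Jordan plane. -/
abbrev jordan (k : Type*) [Field k] {A : Type*} [Ring A] [Algebra k A] (y z : A) :
    Subalgebra k A := Algebra.adjoin k {z, y ^ 2}

theorem z_mem_jordan (k : Type*) [Field k] {A : Type*} [Ring A] [Algebra k A] (y z : A) :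
    z ∈ jordan k y z := Algebra.subset_adjoin (Or.inl rfl)

theorem y_sq_mem_jordan (k : Type*) [Field k] {A : Type*} [Ring A] [Algebra k A] (y z : A) :
    y ^ 2 ∈ jordan k y z := Algebra.subset_adjoin (Or.inr rfl)

open Polynomial

/-- The element of the Jordan subalgebra with normal form `P`, for a polynomial `P` in `z` and
`t = y ^ 2`. -/
noncomputable def ofPoly (k : Type*) [Field k] {A : Type*} [Ring A] [Algebra k A] (y z : A) :
    k[X][X] →ₗ[k] A :=
  (polyBasis k).constr k fun p => z ^ p.2 * (y ^ 2) ^ p.1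

theorem ofPoly_basis {k : Type*} [Field k] {A : Type*} [Ring A] [Algebra k A] (y z : A)
    (p : ℕ × ℕ) : ofPoly k y z (polyBasis k p) = z ^ p.2 * (y ^ 2) ^ p.1 :=
  Module.Basis.constr_basis _ _ _ _

@[elab_as_elim]
theorem poly_induction {k : Type*} [Field k] {p : k[X][X] → Prop}
    (hb : ∀ i, p (polyBasis k i)) (h0 : p 0) (hadd : ∀ P Q, p P → p Q → p (P + Q))
    (hsmul : ∀ (r : k) P, p P → p (r • P)) (P : k[X][X]) : p P := by
  induction (polyBasis k).mem_span P using Submodule.span_induction with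
  | mem P hP => obtain ⟨i, rfl⟩ := hP; exact hb i
  | zero => exact h0
  | add P Q _ _ iP iQ => exact hadd P Q iP iQ
  | smul r P _ iP => exact hsmul r P iP

theorem ofPoly_X_mul {k : Type*} [Field k] {A : Type*} [Ring A] [Algebra k A] (y z : A)
    (P : k[X][X]) : ofPoly k y z (X * P) = z * ofPoly k y z P := by
  induction P using poly_induction with
  | hb i =>
    have e : X * polyBasis k i = polyBasis k (i.1, i.2 + 1) := by
      rw [polyBasis_apply, polyBasis_apply, pow_succ', mul_assoc]
    rw [e, ofPoly_basis, ofPoly_basis, pow_succ', mul_assoc]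
  | h0 => simp
  | hadd P Q hP hQ => rw [mul_add, map_add, hP, hQ, map_add, mul_add]
  | hsmul r P hP => rw [mul_smul_comm, map_smul, hP, map_smul, mul_smul_comm]

theorem ofPoly_X_pow_mul {k : Type*} [Field k] {A : Type*} [Ring A] [Algebra k A] (y z : A)
    (n : ℕ) (P : k[X][X]) : ofPoly k y z (X ^ n * P) = z ^ n * ofPoly k y z P := by
  induction n with
  | zero => simp
  | succ n ih => rw [pow_succ', mul_assoc, ofPoly_X_mul, ih, pow_succ', mul_assoc]

/-- Modulo higher powers of `z`, the operator `y ^ 2` is multiplication by the polynomial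
`y ^ 2`. -/
theorem repY_sq_pow_coeff (k : Type*) [Field k] (m n : ℕ) {v : k[X][X] × k[X][X]}
    (hv : ∀ i < m, v.1.coeff i = 0 ∧ v.2.coeff i = 0) :
    (∀ i < m, (((repY k ^ 2) ^ n) v).1.coeff i = 0 ∧ (((repY k ^ 2) ^ n) v).2.coeff i = 0) ∧
    (((repY k ^ 2) ^ n) v).1.coeff m = (X ^ 2) ^ n * v.1.coeff m ∧
    (((repY k ^ 2) ^ n) v).2.coeff m = (X ^ 2) ^ n * v.2.coeff m := by
  induction n with
  | zero => simpa using hv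
  | succ n ih =>
    obtain ⟨h0, h1, h2⟩ := ih
    rw [pow_succ', Module.End.mul_apply]
    generalize ((repY k ^ 2) ^ n) v = w at *
    have key : ∀ f : k[X][X], (∀ i < m, f.coeff i = 0) → ∀ i ≤ m,
        (X ^ 2 * derivative f).coeff i = 0 ∧ (X * f).coeff i = 0 := by
      intro f hf i hi
      constructor
      · rw [coeff_X_pow_mul']
        split_ifs with h
        · rw [coeff_derivative, hf _ (by omega), zero_mul]
        · rfl
      · rcases i with _ | i
        · exact coeff_X_mul_zero f
        · rw [coeff_X_mul]; exact hf i (by omega)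
    have k1 := key w.1 fun i hi => (h0 i hi).1
    have k2 := key w.2 fun i hi => (h0 i hi).2
    rw [repY_sq_apply]
    simp only [coeff_add, ← C_pow, coeff_C_mul]
    refine ⟨fun i hi => ?_, ?_, ?_⟩
    · rw [(k1 i hi.le).1, (k2 i hi.le).1, (k2 i hi.le).2, (h0 i hi).1, (h0 i hi).2]
      simp
    · rw [(k1 m le_rfl).1, h1]; ring
    · rw [(k2 m le_rfl).1, (k2 m le_rfl).2, h2]; ring

end SuperJordan

namespace IsSuperJordanPlane

open SuperJordan Polynomial

variable {k : Type u} [Field k] {A : Type u} [Ring A] [Algebra k A] {x y z : A}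

/-- An element of the Jordan subalgebra acts on the lowest `z`-coefficient of a normal form as
multiplication by its own part of degree zero in `z`, with `y ^ 2` substituted for `t`. -/
theorem rep_ofPoly_coeff (h : IsSuperJordanPlane k x y z) (P : k[X][X]) (m : ℕ)
    {v : k[X][X] × k[X][X]} (hv : ∀ i < m, v.1.coeff i = 0 ∧ v.2.coeff i = 0) :
    (h.rep (ofPoly k y z P) v).1.coeff m = expand k 2 (P.coeff 0) * v.1.coeff m ∧
    (h.rep (ofPoly k y z P) v).2.coeff m = expand k 2 (P.coeff 0) * v.2.coeff m := by
  induction P using poly_induction with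
  | hb p =>
    obtain ⟨c, b⟩ := p
    obtain ⟨h0, h1, h2⟩ := repY_sq_pow_coeff k m c hv
    rw [ofPoly_basis, map_mul, map_pow, map_pow, map_pow, rep_y, rep_z, Module.End.mul_apply,
      repZ_pow_apply, polyBasis_apply]
    rcases b with _ | b
    · have e : expand k 2 ((C X ^ c : k[X][X]).coeff 0) = (X ^ 2) ^ c := by
        rw [← C_pow, coeff_C_zero, map_pow, expand_X]
      simp only [pow_zero, one_mul]
      rw [h1, h2, e]
      exact ⟨rfl, rfl⟩
    · have e : (X ^ (b + 1) * C X ^ c : k[X][X]).coeff 0 = 0 := by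
        rw [pow_succ', mul_assoc, coeff_X_mul_zero]
      have e' : ∀ f : k[X][X], (∀ i < m, f.coeff i = 0) → (X ^ (b + 1) * f).coeff m = 0 := by
        intro f hf
        rw [coeff_X_pow_mul']
        split_ifs with hb
        · exact hf _ (by omega)
        · rfl
      simp only [e, map_zero, zero_mul]
      exact ⟨e' _ fun i hi => (h0 i hi).1, e' _ fun i hi => (h0 i hi).2⟩
  | h0 => simp
  | hadd P Q hP hQ =>
    simp only [map_add, LinearMap.add_apply, Prod.fst_add, Prod.snd_add, coeff_add, hP.1, hP.2,
      hQ.1, hQ.2, add_mul, and_self]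
  | hsmul r P hP =>
    simp only [map_smul, LinearMap.smul_apply, Prod.smul_fst, Prod.smul_snd, coeff_smul, hP.1,
      hP.2, smul_mul_assoc, and_self]

theorem rep_ofPoly_ne_zero (h : IsSuperJordanPlane k x y z) {P : k[X][X]} (hP : P ≠ 0)
    {v : k[X][X] × k[X][X]} (hv : v ≠ 0) : h.rep (ofPoly k y z P) v ≠ 0 := by
  classical
  obtain ⟨P', hP', hdvd⟩ := exists_eq_pow_rootMultiplicity_mul_and_not_dvd P hP 0
  rw [C_0, sub_zero] at hP' hdvd
  rw [hP', ofPoly_X_pow_mul, map_mul, map_pow, rep_z, Module.End.mul_apply, repZ_pow_apply]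
  rw [X_dvd_iff] at hdvd
  have hex : ∃ m, ¬(v.1.coeff m = 0 ∧ v.2.coeff m = 0) := by
    by_contra! hcon
    exact hv (Prod.ext (Polynomial.ext fun i => by simpa using (hcon i).1)
      (Polynomial.ext fun i => by simpa using (hcon i).2))
  have hlow : ∀ i < Nat.find hex, v.1.coeff i = 0 ∧ v.2.coeff i = 0 := fun i hi =>
    not_not.mp (Nat.find_min hex hi)
  obtain ⟨e1, e2⟩ := h.rep_ofPoly_coeff P' (Nat.find hex) hlow
  have hexp : expand k 2 (P'.coeff 0) ≠ 0 := by rwa [Ne, expand_eq_zero two_pos]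
  intro hzero
  rw [Prod.mk_eq_zero, mul_eq_zero_iff_left (pow_ne_zero _ X_ne_zero),
    mul_eq_zero_iff_left (pow_ne_zero _ X_ne_zero)] at hzero
  rw [hzero.1, coeff_zero, eq_comm, mul_eq_zero_iff_left hexp] at e1
  rw [hzero.2, coeff_zero, eq_comm, mul_eq_zero_iff_left hexp] at e2
  exact Nat.find_spec hex ⟨e1, e2⟩

theorem exists_ofPoly_eq (h : IsSuperJordanPlane k x y z) {j : A} (hj : j ∈ jordan k y z) :
    ∃ P : k[X][X], ofPoly k y z P = j := by
  suffices ∀ P, ∃ P', ofPoly k y z P' = j * ofPoly k y z P by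
    obtain ⟨P, hP⟩ := this (polyBasis k (0, 0))
    exact ⟨P, by rw [hP, ofPoly_basis]; simp⟩
  induction hj using Algebra.adjoin_induction with
  | mem a ha =>
    rcases ha with rfl | rfl
    · exact fun P => ⟨X * P, ofPoly_X_mul _ _ P⟩
    · intro P
      change y ^ 2 * ofPoly k y z P ∈ LinearMap.range (ofPoly k y z)
      induction P using poly_induction with
      | hb p =>
        refine ⟨polyBasis k (p.1 + 1, p.2) + p.2 • polyBasis k (p.1, p.2 + 1), ?_⟩
        rw [map_add, map_nsmul, ofPoly_basis, ofPoly_basis, ofPoly_basis, ← mul_assoc,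
          h.y_sq_mul_z_pow, add_mul, pow_succ' (y ^ 2), mul_assoc, smul_mul_assoc]
      | h0 => simp
      | hadd P Q hP hQ => rw [map_add, mul_add]; exact add_mem hP hQ
      | hsmul r P hP => rw [map_smul, mul_smul_comm]; exact Submodule.smul_mem _ _ hP
  | algebraMap r => exact fun P => ⟨r • P, by rw [map_smul, Algebra.smul_def]⟩
  | add a b _ _ iha ihb =>
    intro P
    obtain ⟨Q, hQ⟩ := iha P
    obtain ⟨Q', hQ'⟩ := ihb P
    exact ⟨Q + Q', by rw [map_add, hQ, hQ', add_mul]⟩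
  | mul a b _ _ iha ihb =>
    intro P
    obtain ⟨Q, hQ⟩ := ihb P
    obtain ⟨Q', hQ'⟩ := iha Q
    exact ⟨Q', by rw [hQ', hQ, mul_assoc]⟩

theorem eq_zero_of_jordan_mul (h : IsSuperJordanPlane k x y z) {j a : A} (hj : j ∈ jordan k y z)
    (hj0 : j ≠ 0) (ha : j * a = 0) : a = 0 := by
  obtain ⟨P, rfl⟩ := h.exists_ofPoly_eq hj
  have hP : P ≠ 0 := by rintro rfl; exact hj0 (map_zero _)
  refine h.eq_zero_of_rep_eq_zero ?_
  by_contra hv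
  refine h.rep_ofPoly_ne_zero hP hv ?_
  rw [← Module.End.mul_apply, ← map_mul, ha, map_zero, LinearMap.zero_apply]

/-! ### The anti-automorphism exchanging left and right -/

open MulOpposite in
theorem exists_rev (h : IsSuperJordanPlane k x y z) :
    ∃ τ : A →ₐ[k] Aᵐᵒᵖ, τ x = op (-x) ∧ τ y = op y ∧ τ z = op (-z) := by
  have hrel : SuperJordanRelations (op (-x)) (op y) (op (-z)) :=
    { x_mul_x := by rw [← op_mul, neg_mul_neg, h.x_mul_x, op_zero]
      y_mul_x := by
        rw [← op_mul, ← op_mul, ← op_sub, mul_neg, h.y_mul_x]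
        congr 1
        noncomm_ring
      y_mul_z := by
        rw [← op_mul, ← op_mul, ← op_mul, ← op_add, mul_neg, h.y_mul_z, neg_mul_neg, ← h.x_mul_z]
        congr 1
        noncomm_ring }
  obtain ⟨τ, hx, hy⟩ := h.exists_lift hrel
  refine ⟨τ, hx, hy, ?_⟩
  have hz : z = x * y + y * x := by rw [h.y_mul_x]; abel
  rw [hz, map_add, map_mul, map_mul, hx, hy, hrel.y_mul_x, ← hz]
  abel

/-- The anti-automorphism `x ↦ -x`, `y ↦ y`, as a linear map. -/
noncomputable def rev (h : IsSuperJordanPlane k x y z) : A →ₗ[k] A :=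
  (MulOpposite.opLinearEquiv k).symm.toLinearMap ∘ₗ h.exists_rev.choose.toLinearMap

section rev
variable (h : IsSuperJordanPlane k x y z)

theorem rev_def (a : A) : h.rev a = (h.exists_rev.choose a).unop := rfl
theorem rev_x : h.rev x = -x := by rw [rev_def, h.exists_rev.choose_spec.1, MulOpposite.unop_op]
theorem rev_y : h.rev y = y := by rw [rev_def, h.exists_rev.choose_spec.2.1, MulOpposite.unop_op]
theorem rev_z : h.rev z = -z := by rw [rev_def, h.exists_rev.choose_spec.2.2, MulOpposite.unop_op]

theorem rev_mul (a b : A) : h.rev (a * b) = h.rev b * h.rev a := by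
  rw [rev_def, map_mul, MulOpposite.unop_mul]; rfl

theorem rev_algebraMap (r : k) : h.rev (algebraMap k A r) = algebraMap k A r := by
  rw [rev_def, AlgHom.commutes, MulOpposite.algebraMap_apply, MulOpposite.unop_op]

theorem rev_rev (a : A) : h.rev (h.rev a) = a := by
  induction a using h.induction with
  | hx => rw [rev_x, map_neg, rev_x, neg_neg]
  | hy => rw [rev_y, rev_y]
  | hs r => rw [rev_algebraMap, rev_algebraMap]
  | hadd a b iha ihb => rw [map_add, map_add, iha, ihb]
  | hmul a b iha ihb => rw [rev_mul, rev_mul, iha, ihb]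

theorem rev_eq_zero_iff {a : A} : h.rev a = 0 ↔ a = 0 :=
  ⟨fun e => by rw [← h.rev_rev a, e, map_zero], fun e => by rw [e, map_zero]⟩

theorem rev_mem_jordan {j : A} (hj : j ∈ jordan k y z) : h.rev j ∈ jordan k y z := by
  induction hj using Algebra.adjoin_induction with
  | mem a ha =>
    rcases ha with rfl | rfl
    · rw [rev_z]; exact neg_mem (z_mem_jordan k y _)
    · rw [pow_two, rev_mul, rev_y, ← pow_two]; exact y_sq_mem_jordan k y z
  | algebraMap r => rw [rev_algebraMap]; exact Subalgebra.algebraMap_mem _ r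
  | add a b _ _ iha ihb => rw [map_add]; exact add_mem iha ihb
  | mul a b _ _ iha ihb => rw [rev_mul]; exact mul_mem ihb iha

end rev

theorem eq_zero_of_mul_jordan (h : IsSuperJordanPlane k x y z) {j a : A} (hj : j ∈ jordan k y z)
    (hj0 : j ≠ 0) (ha : a * j = 0) : a = 0 := by
  refine h.rev_eq_zero_iff.mp (h.eq_zero_of_jordan_mul (h.rev_mem_jordan hj)
    (mt h.rev_eq_zero_iff.mp hj0) ?_)
  rw [← rev_mul, ha, map_zero]

/-- Nonzero elements of the Jordan subalgebra are regular in the super Jordan plane. -/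
theorem jordan_mem_nonZeroDivisors (h : IsSuperJordanPlane k x y z) {j : A}
    (hj : j ∈ jordan k y z) (hj0 : j ≠ 0) : j ∈ nonZeroDivisors A :=
  mem_nonZeroDivisors_iff.mpr
    ⟨fun _ => h.eq_zero_of_jordan_mul hj hj0, fun _ => h.eq_zero_of_mul_jordan hj hj0⟩

theorem y_sq_ne_zero (h : IsSuperJordanPlane k x y z) : y ^ 2 ≠ 0 := by
  simpa [pbw] using h.linearIndependent_pbw.ne_zero (Sum.inl (2, 0))

theorem z_ne_zero (h : IsSuperJordanPlane k x y z) : z ≠ 0 := by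
  simpa [pbw] using h.linearIndependent_pbw.ne_zero (Sum.inl (0, 1))

theorem z_mem_nonZeroDivisors (h : IsSuperJordanPlane k x y z) : z ∈ nonZeroDivisors A :=
  h.jordan_mem_nonZeroDivisors (z_mem_jordan k y z) h.z_ne_zero

theorem y_mem_nonZeroDivisors (h : IsSuperJordanPlane k x y z) : y ∈ nonZeroDivisors A := by
  refine mem_nonZeroDivisors_iff.mpr ⟨fun a ha => ?_, fun a ha => ?_⟩
  · refine h.eq_zero_of_jordan_mul (y_sq_mem_jordan k y z) h.y_sq_ne_zero ?_
    rw [pow_two, mul_assoc, ha, mul_zero]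
  · refine h.eq_zero_of_mul_jordan (y_sq_mem_jordan k y z) h.y_sq_ne_zero ?_
    rw [pow_two, ← mul_assoc, ha, zero_mul]

/-! ### The Ore conditions -/

/-- A space of elements of the Jordan subalgebra inside `box (2 * m)`, of dimension `2 * m ^ 2`. -/
theorem exists_jordan_box (h : IsSuperJordanPlane k x y z) (m : ℕ) :
    ∃ W : Submodule k A, (∀ a ∈ W, a ∈ jordan k y z) ∧ W ≤ box k x y z (2 * m) ∧
      Module.finrank k W = 2 * (m * m) := by
  let i : Fin m × Fin (2 * m) → (ℕ × ℕ) ⊕ (ℕ × ℕ) := fun p => Sum.inl (2 * p.1, p.2)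
  have hi : Function.Injective i := by
    rintro ⟨⟨a, _⟩, ⟨b, _⟩⟩ ⟨⟨c, _⟩, ⟨d, _⟩⟩ hab
    simp only [i, Sum.inl.injEq, Prod.mk.injEq] at hab
    simp only [Prod.mk.injEq, Fin.mk.injEq]
    omega
  refine ⟨Submodule.span k (Set.range (pbw x y z ∘ i)), fun a ha => ?_, ?_, ?_⟩
  · have : Submodule.span k (Set.range (pbw x y z ∘ i)) ≤
        Subalgebra.toSubmodule (jordan k y z) := by
      refine Submodule.span_le.mpr ?_
      rintro _ ⟨p, rfl⟩
      change z ^ (p.2 : ℕ) * y ^ (2 * (p.1 : ℕ)) ∈ jordan k y z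
      rw [pow_mul]
      exact mul_mem (pow_mem (z_mem_jordan k y z) _) (pow_mem (y_sq_mem_jordan k y z) _)
    exact this ha
  · refine Submodule.span_le.mpr ?_
    rintro _ ⟨⟨⟨c, hc⟩, ⟨b, hb⟩⟩, rfl⟩
    exact mem_box_left k x y z hb (by omega)
  · rw [finrank_span_eq_card (h.linearIndependent_pbw.comp i hi)]
    simp
    ring

/-- The right Ore condition, with denominators in the Jordan subalgebra: if `s` is left regular,
the multiples `s * b` for `b` in a large box leave only linearly many dimensions of the next
boxes uncovered, whereas the multiples `r * j` with `j` in the Jordan subalgebra fill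
quadratically many. -/
theorem exists_jordan_mul_eq_mul (h : IsSuperJordanPlane k x y z) (r : A) {s : A}
    (hs : ∀ a, s * a = 0 → a = 0) : ∃ j ∈ jordan k y z, j ≠ 0 ∧ ∃ r', r * j = s * r' := by
  obtain ⟨d₁, hd₁⟩ := h.exists_mul_mem_box r
  obtain ⟨d₂, hd₂⟩ := h.exists_mul_mem_box s
  obtain ⟨d, h₁, h₂⟩ : ∃ d, d₁ ≤ d ∧ d₂ ≤ d := ⟨max d₁ d₂, le_max_left _ _, le_max_right _ _⟩
  -- any `m` with `2 m ^ 2 > 8 m d + 2 d ^ 2` will do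
  let m := 5 * d + 1
  obtain ⟨W, hWJ, hWU, hW⟩ := h.exists_jordan_box m
  have : FiniteDimensional k W := Submodule.finiteDimensional_of_le hWU
  let Φ : (W × box k x y z (2 * m)) →ₗ[k] box k x y z (2 * m + d) :=
    LinearMap.codRestrict _
      ((LinearMap.mulLeft k r ∘ₗ W.subtype).coprod
        (-(LinearMap.mulLeft k s ∘ₗ (box k x y z (2 * m)).subtype)))
      (fun v => add_mem (box_mono k x y z (by omega) (hd₁ _ _ (hWU v.1.2)))
        (neg_mem (box_mono k x y z (by omega) (hd₂ _ _ v.2.2))))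
  have hker : LinearMap.ker Φ ≠ ⊥ := by
    refine LinearMap.ker_ne_bot_of_finrank_lt ?_
    rw [Module.finrank_prod, hW, h.finrank_box, h.finrank_box]
    simp only [m]
    nlinarith
  obtain ⟨⟨⟨j, hjW⟩, ⟨u, hu⟩⟩, hv, hv0⟩ := Submodule.exists_mem_ne_zero_of_ne_bot hker
  have e : r * j = s * u := by
    have := congrArg Subtype.val (LinearMap.mem_ker.mp hv)
    exact sub_eq_zero.mp ((sub_eq_add_neg _ _).trans this)
  refine ⟨j, hWJ j hjW, ?_, u, e⟩
  rintro rfl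
  rw [mul_zero] at e
  have := hs u e.symm
  subst this
  exact hv0 rfl

theorem exists_jordan_mul_eq_mul' (h : IsSuperJordanPlane k x y z) (r : A) {s : A}
    (hs : ∀ a, a * s = 0 → a = 0) : ∃ j ∈ jordan k y z, j ≠ 0 ∧ ∃ r', j * r = r' * s := by
  obtain ⟨j, hj, hj0, r', e⟩ := h.exists_jordan_mul_eq_mul (h.rev r) (s := h.rev s) (by
    intro a ha
    refine h.rev_eq_zero_iff.mp (hs _ ?_)
    rw [← h.rev_rev s, ← rev_mul, ha, map_zero])
  refine ⟨h.rev j, h.rev_mem_jordan hj, mt h.rev_eq_zero_iff.mp hj0, h.rev r', ?_⟩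
  rw [← h.rev_rev r, ← rev_mul, e, rev_mul, rev_rev]

end IsSuperJordanPlane

/-! ### Superalgebras -/

section Superalgebra

variable {k : Type*} [Field k] {A : Type*} [Ring A] [Algebra k A] (𝒜 : ZMod 2 → Submodule k A)
  [GradedAlgebra 𝒜]

theorem decompose_zero_add_decompose_one (a : A) :
    (DirectSum.decompose 𝒜 a 0 : A) + DirectSum.decompose 𝒜 a 1 = a := by
  conv_rhs => rw [← (DirectSum.decompose 𝒜).symm_apply_apply a,
    ← DirectSum.sum_univ_of (DirectSum.decompose 𝒜 a), DirectSum.decompose_symm_sum]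
  simp only [DirectSum.decompose_symm_of]
  exact (Fin.sum_univ_two (M := A) fun i : ZMod 2 => (DirectSum.decompose 𝒜 a i : A)).symm

variable {𝒜}

theorem eq_zero_of_mem_of_mem {a : A} (h0 : a ∈ 𝒜 0) (h1 : a ∈ 𝒜 1) : a = 0 := by
  rw [← DirectSum.decompose_of_mem_same 𝒜 h0, DirectSum.decompose_of_mem_ne 𝒜 h1 (by decide)]

theorem mem_zero_of_mul_mem_one {a b : A} (ha : a ∈ 𝒜 1) (hb : b ∈ 𝒜 1) : a * b ∈ 𝒜 0 :=
  (show (1 : ZMod 2) + 1 = 0 by decide) ▸ SetLike.mul_mem_graded ha hb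

theorem mul_mem_of_mem_zero {i : ZMod 2} {a b : A} (ha : a ∈ 𝒜 i) (hb : b ∈ 𝒜 0) :
    a * b ∈ 𝒜 i := by
  simpa using SetLike.mul_mem_graded ha hb

end Superalgebra

/-! ### Rings of fractions from Ore conditions -/

/-- A submonoid of regular elements satisfying both Ore conditions has a ring of fractions, namely
Mathlib's left Ore localization. -/
theorem exists_isRightRingOfFractions {k : Type u} [Field k] {R : Type u} [Ring R] [Algebra k R]
    {S : Submonoid R} (hS : S ≤ nonZeroDivisors R) (hl : LeftOreCondition S)
    (hr : RightOreCondition S) :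
    ∃ (Q : Type u) (_ : Ring Q) (_ : Algebra k Q) (ι : R →ₐ[k] Q),
      IsRightRingOfFractions S ι.toRingHom := by
  obtain ⟨hO⟩ : Nonempty (OreLocalization.OreSet S) := by
    refine OreLocalization.nonempty_oreSet_iff.mpr ⟨fun r₁ r₂ s h => ⟨1, ?_⟩, fun r s => ?_⟩
    · rw [← sub_eq_zero, ← sub_mul] at h
      rw [sub_eq_zero.mp ((mem_nonZeroDivisors_iff.mp (hS s.2)).2 _ h)]
    · obtain ⟨r', s', hs', e⟩ := hl r s s.2
      exact ⟨r', ⟨s', hs'⟩, e⟩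
  let f : R →+* OreLocalization S R := OreLocalization.numeratorRingHom
  refine ⟨OreLocalization S R, inferInstance, inferInstance,
    { f with commutes' := fun r => rfl }, ?_, ?_, ?_⟩
  · exact fun s hs => OreLocalization.numerator_isUnit (⟨s, hs⟩ : S)
  · intro q
    induction q using OreLocalization.ind with | _ r s
    obtain ⟨r', s', hs', e⟩ := hr r s s.2
    refine ⟨r', s', hs', ?_⟩
    change OreLocalization.oreDiv r s * OreLocalization.oreDiv s' 1 = OreLocalization.oreDiv r' 1
    rw [OreLocalization.mul_div_one, e, OreLocalization.oreDiv_eq_iff]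
    exact ⟨s, 1, by simp [Submonoid.smul_def], by simp⟩
  · intro r
    have hinj : Function.Injective f := OreLocalization.numeratorHom_inj
      fun s hs => (mem_nonZeroDivisors_iff.mp (hS hs)).1
    constructor
    · intro h
      refine ⟨1, one_mem S, ?_⟩
      rw [mul_one]
      exact hinj (h.trans (map_zero f).symm)
    · rintro ⟨s, hs, e⟩
      rw [(mem_nonZeroDivisors_iff.mp (hS hs)).2 _ e]
      exact map_zero f

theorem IsRightRingOfFractions.injective {R Q : Type*} [Ring R] [Ring Q] {S : Submonoid R}
    {f : R →+* Q} (h : IsRightRingOfFractions S f) (hS : S ≤ nonZeroDivisors R) :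
    Function.Injective f := by
  refine (injective_iff_map_eq_zero f).mpr fun r hr => ?_
  obtain ⟨s, hs, e⟩ := (h.map_eq_zero_iff r).mp hr
  exact (mem_nonZeroDivisors_iff.mp (hS hs)).2 _ e

/-! ### The grading and regular elements of the super Jordan plane -/

namespace SuperJordan

/-- The nonzero elements of the Jordan subalgebra, described as its elements that are regular in
the whole algebra. They suffice as denominators. -/
def jordanDenominators (k : Type*) [Field k] {A : Type*} [Ring A] [Algebra k A] (y z : A) :
    Submonoid A :=
  (jordan k y z).toSubmonoid ⊓ nonZeroDivisors A

end SuperJordan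

namespace IsSuperJordanPlane

open SuperJordan

variable {k : Type u} [Field k] {A : Type u} [Ring A] [Algebra k A] {x y z : A}

theorem mem_jordanDenominators (h : IsSuperJordanPlane k x y z) {j : A} (hj : j ∈ jordan k y z)
    (hj0 : j ≠ 0) : j ∈ jordanDenominators k y z :=
  ⟨hj, h.jordan_mem_nonZeroDivisors hj hj0⟩

section Graded

variable (h : IsSuperJordanPlane k x y z) {ℬ : ZMod 2 → Submodule k A} [GradedAlgebra ℬ]
  (hx : x ∈ ℬ 1) (hy : y ∈ ℬ 1)
include h hx hy

theorem z_mem_zero : z ∈ ℬ 0 := by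
  have hz : z = x * y + y * x := by rw [h.y_mul_x]; abel
  rw [hz]
  exact add_mem (mem_zero_of_mul_mem_one hx hy) (mem_zero_of_mul_mem_one hy hx)

theorem jordan_le_zero {j : A} (hj : j ∈ jordan k y z) : j ∈ ℬ 0 := by
  have hle : jordan k y z ≤ SetLike.GradeZero.subalgebra ℬ := by
    refine Algebra.adjoin_le ?_
    rintro a (rfl | rfl)
    · exact h.z_mem_zero hx hy
    · rw [pow_two]; exact mem_zero_of_mul_mem_one hy hy
  exact hle hj

theorem exists_jordan_add_xy_mul {a : A} (ha : a ∈ ℬ 0) :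
    ∃ j₁ ∈ jordan k y z, ∃ j₂ ∈ jordan k y z, a = j₁ + x * y * j₂ := by
  let J := Subalgebra.toSubmodule (jordan k y z)
  have hxy : x * y ∈ ℬ 0 := mem_zero_of_mul_mem_one hx hy
  have hmono : ∀ b c, z ^ b * (y ^ 2) ^ c ∈ jordan k y z := fun b c =>
    mul_mem (pow_mem (z_mem_jordan k y z) b) (pow_mem (y_sq_mem_jordan k y z) c)
  have key := h.mem_of_pbw_mem (W := J ⊔ J.map (LinearMap.mulLeft k (x * y)))
    (GradedAlgebra.proj ℬ 0) (fun b c => ?_) (fun b c => ?_) a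
  · rw [GradedAlgebra.proj_apply, DirectSum.decompose_of_mem_same ℬ ha] at key
    obtain ⟨j₁, hj₁, _, ⟨j₂, hj₂, rfl⟩, e⟩ := Submodule.mem_sup.mp key
    exact ⟨j₁, hj₁, j₂, hj₂, e.symm⟩
  · rw [GradedAlgebra.proj_apply]
    obtain ⟨d, rfl | rfl⟩ := c.even_or_odd'
    · have hm : z ^ b * y ^ (2 * d) ∈ jordan k y z := by rw [pow_mul]; exact hmono b d
      rw [DirectSum.decompose_of_mem_same ℬ (h.jordan_le_zero hx hy hm)]
      exact Submodule.mem_sup_left hm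
    · have hm : z ^ b * y ^ (2 * d + 1) ∈ ℬ 1 := by
        rw [pow_succ, ← mul_assoc, pow_mul]
        simpa using SetLike.mul_mem_graded (h.jordan_le_zero hx hy (hmono b d)) hy
      rw [DirectSum.decompose_of_mem_ne ℬ hm (by decide)]
      exact zero_mem _
  · rw [GradedAlgebra.proj_apply]
    obtain ⟨d, rfl | rfl⟩ := c.even_or_odd'
    · have hm : x * (z ^ b * y ^ (2 * d)) ∈ ℬ 1 := by
        rw [pow_mul]
        exact mul_mem_of_mem_zero hx (h.jordan_le_zero hx hy (hmono b d))
      rw [DirectSum.decompose_of_mem_ne ℬ hm (by decide)]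
      exact zero_mem _
    · have e : x * (z ^ b * y ^ (2 * d + 1)) = x * y * (z ^ b * (y ^ 2) ^ d) := by
        have hc : x * y * z ^ b = z ^ b * (x * y) :=
          ((show Commute (x * y) z from h.xy_mul_z).pow_right b).eq
        rw [← mul_assoc (x * y), hc, ← mul_assoc, h.x_mul_z_pow, pow_succ', pow_mul, mul_assoc,
          mul_assoc, mul_assoc]
      rw [e, DirectSum.decompose_of_mem_same ℬ
        (mul_mem_of_mem_zero hxy (h.jordan_le_zero hx hy (hmono b d)))]
      exact Submodule.mem_sup_right ⟨_, hmono b d, rfl⟩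

/-- The homogeneous form of the right Ore condition, with denominators in the Jordan
subalgebra. -/
theorem exists_mul_eq_mul_of_mem {i : ZMod 2} {r s : A} (hr : r ∈ ℬ i) (hs : s ∈ ℬ 0)
    (hs' : s ∈ nonZeroDivisors A) :
    ∃ j ∈ jordanDenominators k y z, ∃ r' ∈ ℬ i, r * j = s * r' := by
  obtain ⟨j, hj, hj0, r', e⟩ := h.exists_jordan_mul_eq_mul r (mem_nonZeroDivisors_iff.mp hs').1
  refine ⟨j, h.mem_jordanDenominators hj hj0, DirectSum.decompose ℬ r' i, SetLike.coe_mem _, ?_⟩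
  rw [← DirectSum.coe_decompose_mul_of_left_mem_zero ℬ hs, ← e,
    DirectSum.decompose_of_mem_same ℬ (mul_mem_of_mem_zero hr (h.jordan_le_zero hx hy hj))]

omit hx in
/-- Multiplication by the regular odd element `y` moves an annihilated odd element into the even
part, so regular elements of the even part are regular in the whole algebra. -/
theorem coe_mem_nonZeroDivisors {s : SetLike.GradeZero.subalgebra ℬ}
    (hs : s ∈ nonZeroDivisors (SetLike.GradeZero.subalgebra ℬ)) : (s : A) ∈ nonZeroDivisors A := by
  obtain ⟨hl, hr⟩ := mem_nonZeroDivisors_iff.mp hs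
  obtain ⟨yl, yr⟩ := mem_nonZeroDivisors_iff.mp h.y_mem_nonZeroDivisors
  have hl' : ∀ a ∈ ℬ 0, (s : A) * a = 0 → a = 0 := fun a ha e =>
    congrArg Subtype.val (hl ⟨a, ha⟩ (Subtype.ext e))
  have hr' : ∀ a ∈ ℬ 0, a * (s : A) = 0 → a = 0 := fun a ha e =>
    congrArg Subtype.val (hr ⟨a, ha⟩ (Subtype.ext e))
  refine mem_nonZeroDivisors_iff.mpr ⟨fun a ha => ?_, fun a ha => ?_⟩
  · have e (i) : (s : A) * DirectSum.decompose ℬ a i = 0 := by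
      rw [← DirectSum.coe_decompose_mul_of_left_mem_zero ℬ s.2, ha, DirectSum.decompose_zero]
      rfl
    rw [← decompose_zero_add_decompose_one ℬ a, hl' _ (SetLike.coe_mem _) (e 0), zero_add]
    refine yr _ (hl' _ (mem_zero_of_mul_mem_one (SetLike.coe_mem _) hy) ?_)
    rw [← mul_assoc, e 1, zero_mul]
  · have e (i) : (DirectSum.decompose ℬ a i : A) * s = 0 := by
      rw [← DirectSum.coe_decompose_mul_of_right_mem_zero ℬ s.2, ha, DirectSum.decompose_zero]
      rfl
    rw [← decompose_zero_add_decompose_one ℬ a, hr' _ (SetLike.coe_mem _) (e 0), zero_add]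
    refine yl _ (hr' _ (mem_zero_of_mul_mem_one hy (SetLike.coe_mem _)) ?_)
    rw [mul_assoc, e 1, mul_zero]

theorem jordanDenominators_le :
    jordanDenominators k y z ≤ SetLike.homogeneousSubmonoid ℬ ⊓ nonZeroDivisors A := fun _ hj =>
  ⟨⟨0, h.jordan_le_zero hx hy hj.1⟩, hj.2⟩

theorem leftOreCondition :
    LeftOreCondition (SetLike.homogeneousSubmonoid ℬ ⊓ nonZeroDivisors A) := fun r s hs => by
  obtain ⟨j, hj, hj0, r', e⟩ := h.exists_jordan_mul_eq_mul' r (mem_nonZeroDivisors_iff.mp hs.2).2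
  exact ⟨r', j, h.jordanDenominators_le hx hy (h.mem_jordanDenominators hj hj0), e⟩

theorem rightOreCondition :
    RightOreCondition (SetLike.homogeneousSubmonoid ℬ ⊓ nonZeroDivisors A) := fun r s hs => by
  obtain ⟨j, hj, hj0, r', e⟩ := h.exists_jordan_mul_eq_mul r (mem_nonZeroDivisors_iff.mp hs.2).1
  exact ⟨r', j, h.jordanDenominators_le hx hy (h.mem_jordanDenominators hj hj0), e⟩

end Graded

/-! ### Change of denominators -/

section Denominators

variable {Q : Type v} [Ring Q] [Algebra k Q] {ι : A →ₐ[k] Q}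

/-- The nonzero elements of the Jordan subalgebra suffice as denominators. -/
theorem isRightRingOfFractions_jordan (h : IsSuperJordanPlane k x y z) {S : Submonoid A}
    (hι : IsRightRingOfFractions S ι.toRingHom) (hS : S ≤ nonZeroDivisors A)
    (hJ : jordanDenominators k y z ≤ S) :
    IsRightRingOfFractions (jordanDenominators k y z) ι.toRingHom where
  isUnit j hj := hι.isUnit j (hJ hj)
  exists_fraction q := by
    obtain ⟨r, s, hs, e⟩ := hι.exists_fraction q
    obtain ⟨j, hj, hj0, r', e'⟩ :=
      h.exists_jordan_mul_eq_mul 1 (mem_nonZeroDivisors_iff.mp (hS hs)).1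
    rw [one_mul] at e'
    exact ⟨r * r', j, h.mem_jordanDenominators hj hj0,
      by rw [e', map_mul, ← mul_assoc, e, map_mul]⟩
  map_eq_zero_iff r := by
    refine ⟨fun hr => ⟨1, one_mem _, ?_⟩, ?_⟩
    · rw [mul_one]
      exact hι.injective hS (hr.trans (map_zero _).symm)
    · rintro ⟨s, hs, e⟩
      rw [(mem_nonZeroDivisors_iff.mp hs.2).2 _ e, map_zero]

variable (h : IsSuperJordanPlane k x y z)
  (hι : IsRightRingOfFractions (jordanDenominators k y z) ι.toRingHom)
include h hι

omit h in
theorem injective_of_fractions : Function.Injective ι :=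
  hι.injective inf_le_right

/-- By the Ore conditions, all regular elements of the plane become invertible. -/
theorem isUnit_map {s : A} (hs : s ∈ nonZeroDivisors A) : IsUnit (ι s) := by
  obtain ⟨hl, hr⟩ := mem_nonZeroDivisors_iff.mp hs
  obtain ⟨j, hj, hj0, r, e⟩ := h.exists_jordan_mul_eq_mul 1 hl
  obtain ⟨j', hj', hj0', r', e'⟩ := h.exists_jordan_mul_eq_mul' 1 hr
  obtain ⟨u, hu⟩ := hι.isUnit j (h.mem_jordanDenominators hj hj0)
  obtain ⟨u', hu'⟩ := hι.isUnit j' (h.mem_jordanDenominators hj' hj0')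
  change _ = ι j at hu
  change _ = ι j' at hu'
  have h1 : ι s * (ι r * ↑u⁻¹) = 1 := by
    rw [← mul_assoc, ← map_mul, ← e, one_mul, ← hu, Units.mul_inv]
  have h2 : ↑u'⁻¹ * ι r' * ι s = 1 := by
    rw [mul_assoc, ← map_mul, ← e', mul_one, ← hu', Units.inv_mul]
  rw [left_inv_eq_right_inv h2 h1] at h2
  exact ⟨⟨ι s, _, h1, h2⟩, rfl⟩

theorem isRightRingOfFractions_of_le {S : Submonoid A} (hS : S ≤ nonZeroDivisors A)
    (hJ : jordanDenominators k y z ≤ S) : IsRightRingOfFractions S ι.toRingHom where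
  isUnit _ hs := h.isUnit_map hι (hS hs)
  exists_fraction q := by
    obtain ⟨r, j, hj, e⟩ := hι.exists_fraction q
    exact ⟨r, j, hJ hj, e⟩
  map_eq_zero_iff r := by
    refine ⟨fun hr => ⟨1, one_mem _, ?_⟩, ?_⟩
    · rw [mul_one]
      exact injective_of_fractions hι (hr.trans (map_zero _).symm)
    · rintro ⟨s, hs, e⟩
      rw [(mem_nonZeroDivisors_iff.mp (hS hs)).2 _ e, map_zero]

end Denominators

end IsSuperJordanPlane

/-! ### The grading of the ring of fractions -/

namespace IsSuperJordanPlane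

open SuperJordan

variable {k : Type u} [Field k] {A : Type u} [Ring A] [Algebra k A] {x y z : A}
  {Q : Type v} [Ring Q] [Algebra k Q] {ι : A →ₐ[k] Q}
  (h : IsSuperJordanPlane k x y z) {ℬ : ZMod 2 → Submodule k A} [GradedAlgebra ℬ]
  (hx : x ∈ ℬ 1) (hy : y ∈ ℬ 1)
  (hι : IsRightRingOfFractions (jordanDenominators k y z) ι.toRingHom)

/-- The component of parity `i` of the ring of fractions: the fractions with numerator of
parity `i` and denominator in the Jordan subalgebra. -/
def fractionPart (i : ZMod 2) : Submodule k Q where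
  carrier := {q | ∃ j ∈ jordanDenominators k y z, ∃ b ∈ ℬ i, q * ι j = ι b}
  zero_mem' := ⟨1, one_mem _, 0, zero_mem _, by rw [zero_mul, map_zero]⟩
  add_mem' := by
    rintro q₁ q₂ ⟨j₁, hj₁, b₁, hb₁, e₁⟩ ⟨j₂, hj₂, b₂, hb₂, e₂⟩
    obtain ⟨j, hj, r, hr, e⟩ := h.exists_mul_eq_mul_of_mem hx hy
      (h.jordan_le_zero hx hy hj₁.1) (h.jordan_le_zero hx hy hj₂.1) hj₂.2
    refine ⟨j₁ * j, mul_mem hj₁ hj, b₁ * j + b₂ * r,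
      add_mem (mul_mem_of_mem_zero hb₁ (h.jordan_le_zero hx hy hj.1))
        (mul_mem_of_mem_zero hb₂ hr), ?_⟩
    have h₂ : q₂ * ι (j₁ * j) = ι (b₂ * r) := by rw [e, map_mul, ← mul_assoc, e₂, map_mul]
    rw [add_mul, h₂, map_add, map_mul ι b₁, ← e₁, mul_assoc, ← map_mul]
  smul_mem' := by
    rintro c q ⟨j, hj, b, hb, e⟩
    exact ⟨j, hj, c • b, Submodule.smul_mem _ c hb, by rw [smul_mul_assoc, e, map_smul]⟩

theorem map_mem_fractionPart {i : ZMod 2} {b : A} (hb : b ∈ ℬ i) :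
    ι b ∈ h.fractionPart (ι := ι) hx hy i :=
  ⟨1, one_mem _, b, hb, by rw [map_one, mul_one]⟩

theorem left_inverse_mem_fractionPart {s : A} (hs : s ∈ ℬ 0) (hs' : s ∈ nonZeroDivisors A) {w : Q}
    (hw : w * ι s = 1) : w ∈ h.fractionPart (ι := ι) hx hy 0 := by
  obtain ⟨j, hj, r, hr, e⟩ := h.exists_mul_eq_mul_of_mem hx hy (SetLike.one_mem_graded ℬ) hs hs'
  rw [one_mul] at e
  exact ⟨j, hj, r, hr, by rw [e, map_mul, ← mul_assoc, hw, one_mul]⟩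

theorem mul_mem_fractionPart {i l : ZMod 2} {q₁ q₂ : Q}
    (h₁ : q₁ ∈ h.fractionPart (ι := ι) hx hy i) (h₂ : q₂ ∈ h.fractionPart (ι := ι) hx hy l) :
    q₁ * q₂ ∈ h.fractionPart (ι := ι) hx hy (i + l) := by
  obtain ⟨j₁, hj₁, b₁, hb₁, e₁⟩ := h₁
  obtain ⟨j₂, hj₂, b₂, hb₂, e₂⟩ := h₂
  obtain ⟨j, hj, r, hr, e⟩ := h.exists_mul_eq_mul_of_mem hx hy hb₂
    (h.jordan_le_zero hx hy hj₁.1) hj₁.2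
  refine ⟨j₂ * j, mul_mem hj₂ hj, b₁ * r, SetLike.mul_mem_graded hb₁ hr, ?_⟩
  rw [map_mul, mul_assoc, ← mul_assoc q₂, e₂, ← map_mul, e, map_mul, ← mul_assoc, e₁, map_mul]

include hι in
theorem isCompl_fractionPart :
    IsCompl (h.fractionPart (ι := ι) hx hy 0) (h.fractionPart (ι := ι) hx hy 1) := by
  constructor
  · rw [Submodule.disjoint_def]
    rintro q ⟨j₀, hj₀, b₀, hb₀, e₀⟩ ⟨j₁, hj₁, b₁, hb₁, e₁⟩
    obtain ⟨j, hj, r, hr, e⟩ := h.exists_mul_eq_mul_of_mem hx hy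
      (h.jordan_le_zero hx hy hj₀.1) (h.jordan_le_zero hx hy hj₁.1) hj₁.2
    have h₀ : q * ι (j₀ * j) = ι (b₀ * j) := by rw [map_mul, ← mul_assoc, e₀, map_mul]
    have h₁ : q * ι (j₀ * j) = ι (b₁ * r) := by rw [e, map_mul, ← mul_assoc, e₁, map_mul]
    have hb : b₀ * j = b₁ * r := injective_of_fractions hι (h₀.symm.trans h₁)
    have hz : b₀ * j = 0 := eq_zero_of_mem_of_mem
      (mul_mem_of_mem_zero hb₀ (h.jordan_le_zero hx hy hj.1)) (hb ▸ mul_mem_of_mem_zero hb₁ hr)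
    rw [hz, map_zero] at h₀
    exact (hι.isUnit _ (mul_mem hj₀ hj)).mul_left_eq_zero.mp h₀
  · rw [codisjoint_iff, eq_top_iff]
    intro q _
    obtain ⟨b, j, hj, e⟩ := hι.exists_fraction q
    obtain ⟨u, hu⟩ := hι.isUnit j hj
    change _ = ι j at hu
    change q * ι j = ι b at e
    have hq : q = ι (DirectSum.decompose ℬ b 0) * ↑u⁻¹ + ι (DirectSum.decompose ℬ b 1) * ↑u⁻¹ := by
      rw [← add_mul, ← map_add, decompose_zero_add_decompose_one, ← e, ← hu, mul_assoc,
        Units.mul_inv, mul_one]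
    rw [hq]
    have hmem (i) : ι (DirectSum.decompose ℬ b i) * ↑u⁻¹ ∈ h.fractionPart (ι := ι) hx hy i :=
      ⟨j, hj, _, SetLike.coe_mem (DirectSum.decompose ℬ b i), by
        rw [mul_assoc, ← hu, Units.inv_mul, mul_one]⟩
    exact Submodule.add_mem_sup (hmem 0) (hmem 1)

/-- The ring of fractions as a superalgebra. -/
noncomputable abbrev fractionGradedAlgebra : GradedAlgebra (h.fractionPart (ι := ι) hx hy) where
  one_mem := by simpa using h.map_mem_fractionPart (ι := ι) hx hy (SetLike.one_mem_graded ℬ)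
  mul_mem _ _ _ _ h₁ h₂ := h.mul_mem_fractionPart hx hy h₁ h₂
  toDecomposition := DirectSum.IsInternal.chooseDecomposition _
    ((DirectSum.isInternal_submodule_iff_isCompl _ (i := 0) (j := 1) (by decide)
      (Set.eq_univ_of_forall (by decide : ∀ i : ZMod 2, i = 0 ∨ i = 1)).symm).mpr
        (h.isCompl_fractionPart hx hy hι))

include hι in
/-- The even part of the ring of fractions is the ring of fractions of the even part with respect
to all its regular elements. -/
theorem exists_even_fractions [GradedAlgebra (h.fractionPart (ι := ι) hx hy)] :
    ∃ ι₀ : SetLike.GradeZero.subalgebra ℬ →ₐ[k]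
        SetLike.GradeZero.subalgebra (h.fractionPart (ι := ι) hx hy),
      (∀ b, (ι₀ b : Q) = ι b) ∧
      IsRightRingOfFractions (nonZeroDivisors (SetLike.GradeZero.subalgebra ℬ)) ι₀.toRingHom := by
  let ι₀ : SetLike.GradeZero.subalgebra ℬ →ₐ[k]
      SetLike.GradeZero.subalgebra (h.fractionPart (ι := ι) hx hy) :=
    (ι.comp (SetLike.GradeZero.subalgebra ℬ).val).codRestrict _
      fun b => h.map_mem_fractionPart hx hy b.2
  have hι₀ (b) : (ι₀ b : Q) = ι b := rfl
  have hinj : Function.Injective ι₀ := fun a b e =>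
    Subtype.ext (injective_of_fractions hι (congrArg Subtype.val e))
  refine ⟨ι₀, hι₀, ⟨fun s hs => ?_, fun q => ?_, fun r => ⟨fun hr => ?_, ?_⟩⟩⟩
  · have hs' := h.coe_mem_nonZeroDivisors hy hs
    obtain ⟨u, hu⟩ := h.isUnit_map hι hs'
    have hw : ↑u⁻¹ ∈ h.fractionPart (ι := ι) hx hy 0 :=
      h.left_inverse_mem_fractionPart hx hy s.2 hs' (by rw [← hu, Units.inv_mul])
    refine ⟨⟨ι₀ s, ⟨↑u⁻¹, hw⟩, Subtype.ext ?_, Subtype.ext ?_⟩, rfl⟩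
    · change ι s * ↑u⁻¹ = 1
      rw [← hu, Units.mul_inv]
    · change ↑u⁻¹ * ι s = 1
      rw [← hu, Units.inv_mul]
  · obtain ⟨j, hj, b, hb, e⟩ := q.2
    obtain ⟨hl, hr⟩ := mem_nonZeroDivisors_iff.mp hj.2
    refine ⟨⟨b, hb⟩, ⟨j, h.jordan_le_zero hx hy hj.1⟩, mem_nonZeroDivisors_iff.mpr
      ⟨fun a ha => ?_, fun a ha => ?_⟩, Subtype.ext e⟩
    · exact Subtype.ext (hl _ (congrArg Subtype.val ha))
    · exact Subtype.ext (hr _ (congrArg Subtype.val ha))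
  · exact ⟨1, one_mem _, by rw [mul_one]; exact hinj (hr.trans (map_zero ι₀).symm)⟩
  · rintro ⟨s, hs, e⟩
    rw [(mem_nonZeroDivisors_iff.mp hs).2 _ e]
    exact map_zero ι₀

end IsSuperJordanPlane

/-! ### The central idempotents of the even part -/

namespace SuperJordanRelations

variable {Q : Type*} [Ring Q] {x y z w : Q} (h : SuperJordanRelations x y z)
  (hl : w * z = 1) (hr : z * w = 1)
include h hl hr

theorem inv_mul_xy : w * (x * y) = x * y * w := by
  calc w * (x * y) = w * (x * y * z) * w := by rw [mul_assoc, mul_assoc (x * y), hr, mul_one]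
    _ = x * y * w := by rw [h.xy_mul_z, ← mul_assoc w, hl, one_mul]

theorem inv_mul_y_sq : w * y ^ 2 = y ^ 2 * w + 1 := by
  calc w * y ^ 2 = w * (y ^ 2 * z) * w := by rw [mul_assoc, mul_assoc (y ^ 2), hr, mul_one]
    _ = w * z * (y ^ 2 * w) + w * z * (z * w) := by rw [h.y_sq_mul_z]; noncomm_ring
    _ = y ^ 2 * w + 1 := by rw [hl, hr, one_mul, one_mul]

omit hr in
theorem idem_mul_xy : w * (x * y) * (x * y) = x * y := by
  rw [mul_assoc, h.xy_mul_xy, ← mul_assoc, hl, one_mul]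

theorem idem_commute_xy : Commute (w * (x * y)) (x * y) := by
  change _ = _
  rw [h.idem_mul_xy hl, h.inv_mul_xy hl hr, ← mul_assoc, h.xy_mul_xy, ← h.xy_mul_z, mul_assoc,
    hr, mul_one]

theorem idem_mul_z : w * (x * y) * z = x * y := by
  rw [h.inv_mul_xy hl hr, mul_assoc, hl, mul_one]

theorem idem_commute_z : Commute (w * (x * y)) z := by
  change _ = _
  rw [h.idem_mul_z hl hr, ← mul_assoc, hr, one_mul]

theorem idem_commute_y_sq : Commute (w * (x * y)) (y ^ 2) := by
  have h1 : x * y * y ^ 2 = y ^ 2 * (x * y) - z * (x * y) := by rw [h.y_sq_mul_xy]; abel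
  calc w * (x * y) * y ^ 2 = w * y ^ 2 * (x * y) - w * z * (x * y) := by
        rw [mul_assoc, h1]; noncomm_ring
    _ = y ^ 2 * (w * (x * y)) := by rw [h.inv_mul_y_sq hl hr, hl]; noncomm_ring

/-- Conjugation by `y` interchanges the idempotents `e = z⁻¹ x y` and `1 - e`. -/
theorem y_mul_idem : y * (w * (x * y)) = (1 - w * (x * y)) * y := by
  have h1 : w * y = y * w + w * x := by
    calc w * y = w * (y * z) * w := by rw [mul_assoc, mul_assoc y, hr, mul_one]
      _ = w * z * (y * w) + w * x * (z * w) := by rw [h.y_mul_z]; noncomm_ring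
      _ = y * w + w * x := by rw [hl, hr, one_mul, mul_one]
  have h2 : y * w = w * y - w * x := by rw [h1]; abel
  have h3 : w * x * (x * y) = 0 := by rw [mul_assoc, ← mul_assoc x, h.x_mul_x, zero_mul, mul_zero]
  calc y * (w * (x * y)) = w * (y * x) * y - w * x * (x * y) := by
        rw [← mul_assoc, h2]; noncomm_ring
    _ = (w * z - w * (x * y)) * y := by rw [h3, h.y_mul_x]; noncomm_ring
    _ = (1 - w * (x * y)) * y := by rw [hl]

end SuperJordanRelations

theorem SuperJordanRelations.map {A Q F : Type*} [Ring A] [Ring Q] [FunLike F A Q]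
    [RingHomClass F A Q] (f : F) {x y z : A} (h : SuperJordanRelations x y z) :
    SuperJordanRelations (f x) (f y) (f z) where
  x_mul_x := by rw [← map_mul, h.x_mul_x, map_zero]
  y_mul_x := by rw [← map_mul, ← map_mul, h.y_mul_x, map_sub]
  y_mul_z := by rw [← map_mul, ← map_mul, ← map_mul, h.y_mul_z, map_add]

namespace IsSuperJordanPlane

open SuperJordan

variable {k : Type u} [Field k] {A : Type u} [Ring A] [Algebra k A] {x y z : A}
  {Q : Type v} [Ring Q] [Algebra k Q] {ι : A →ₐ[k] Q}
  (h : IsSuperJordanPlane k x y z) {ℬ : ZMod 2 → Submodule k A} [GradedAlgebra ℬ]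
  (hx : x ∈ ℬ 1) (hy : y ∈ ℬ 1)
  (hι : IsRightRingOfFractions (jordanDenominators k y z) ι.toRingHom)
include h hx hy hι

/-- If `f` is central in the even part and multiplication by `f` reduces all even elements to the
Jordan subalgebra, then each even `q` is zero or invertible after multiplication by `f`. -/
theorem mul_eq_zero_or_exists_mul_eq {f : Q}
    (hcomm : ∀ b ∈ ℬ 0, Commute f (ι b))
    (hred : ∀ b ∈ ℬ 0, ∃ j ∈ jordan k y z, f * ι b = f * ι j) {q : Q}
    (hq : q ∈ h.fractionPart (ι := ι) hx hy 0) :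
    Commute f q ∧ (f * q = 0 ∨ ∃ u, u * q = f ∧ q * u = f) := by
  obtain ⟨d, hd, b, hb, e⟩ := hq
  obtain ⟨D, hD⟩ := hι.isUnit d hd
  change _ = ι d at hD
  have hDf : Commute f D := hD ▸ hcomm d (h.jordan_le_zero hx hy hd.1)
  have hqD : q = ι b * ↑D⁻¹ := by rw [← e, ← hD, mul_assoc, Units.mul_inv, mul_one]
  have hqf : Commute f q := hqD ▸ (hcomm b hb).mul_right hDf.units_inv_right
  refine ⟨hqf, ?_⟩
  obtain ⟨j, hj, hfj⟩ := hred b hb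
  by_cases hj0 : j = 0
  · left
    rw [hqD, ← mul_assoc, hfj, hj0, map_zero, mul_zero, zero_mul]
  · right
    obtain ⟨J, hJ⟩ := hι.isUnit j (h.mem_jordanDenominators hj hj0)
    change _ = ι j at hJ
    have hJf : Commute f J := hJ ▸ hcomm j (h.jordan_le_zero hx hy hj)
    have hv : Commute f ↑(J * D⁻¹) := by
      rw [Units.val_mul]; exact hJf.mul_right hDf.units_inv_right
    have hfq : f * q = f * ↑(J * D⁻¹) := by
      rw [hqD, ← mul_assoc, hfj, mul_assoc, ← hJ, ← Units.val_mul]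
    refine ⟨↑(J * D⁻¹)⁻¹ * f, ?_, ?_⟩
    · rw [mul_assoc, hfq, hv.eq, ← mul_assoc, Units.inv_mul, one_mul]
    · rw [← hv.units_inv_right.eq, ← mul_assoc, ← hqf.eq, hfq, mul_assoc, Units.mul_inv, mul_one]

/-- The even part of the ring of fractions is a product of two division rings, interchanged by
`y`: there is an idempotent `e`, with complement `f`, such that both are central in the even
part, every even element is zero or invertible after multiplication by each of them, and
`y e = f y`. -/
theorem exists_idempotents : ∃ e f : Q, e + f = 1 ∧ ι y * e = f * ι y ∧
    ∀ q ∈ h.fractionPart (ι := ι) hx hy 0,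
      (Commute e q ∧ (e * q = 0 ∨ ∃ u, u * q = e ∧ q * u = e)) ∧
      (Commute f q ∧ (f * q = 0 ∨ ∃ u, u * q = f ∧ q * u = f)) := by
  obtain ⟨Z, hZ⟩ := h.isUnit_map hι h.z_mem_nonZeroDivisors
  have hQ := h.map ι
  obtain ⟨w, hl, hr⟩ : ∃ w, w * ι z = 1 ∧ ι z * w = 1 :=
    ⟨↑Z⁻¹, by rw [← hZ, Units.inv_mul], by rw [← hZ, Units.mul_inv]⟩
  set e := w * (ι x * ι y)
  have hexy : e * (ι x * ι y) = ι x * ι y := hQ.idem_mul_xy hl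
  have hez : e * ι z = ι x * ι y := hQ.idem_mul_z hl hr
  have hcJ : ∀ j ∈ jordan k y z, Commute e (ι j) := by
    intro j hj
    induction hj using Algebra.adjoin_induction with
    | mem a ha =>
      rcases ha with rfl | rfl
      · exact hQ.idem_commute_z hl hr
      · rw [map_pow]; exact hQ.idem_commute_y_sq hl hr
    | algebraMap r => rw [AlgHom.commutes]; exact (Algebra.commutes r e).symm
    | add a b _ _ iha ihb => rw [map_add]; exact iha.add_right ihb
    | mul a b _ _ iha ihb => rw [map_mul]; exact iha.mul_right ihb
  have hc : ∀ b ∈ ℬ 0, Commute e (ι b) := by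
    intro b hb
    obtain ⟨j₁, hj₁, j₂, hj₂, rfl⟩ := h.exists_jordan_add_xy_mul hx hy hb
    rw [map_add, map_mul, map_mul]
    exact (hcJ j₁ hj₁).add_right ((hQ.idem_commute_xy hl hr).mul_right (hcJ j₂ hj₂))
  refine ⟨e, 1 - e, by abel, hQ.y_mul_idem hl hr, fun q hq =>
    ⟨h.mul_eq_zero_or_exists_mul_eq hx hy hι hc (fun b hb => ?_) hq,
      h.mul_eq_zero_or_exists_mul_eq hx hy hι
        (fun b hb => (Commute.one_left _).sub_left (hc b hb)) (fun b hb => ?_) hq⟩⟩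
  · -- `e x y = e z`
    obtain ⟨j₁, hj₁, j₂, hj₂, rfl⟩ := h.exists_jordan_add_xy_mul hx hy hb
    refine ⟨j₁ + z * j₂, add_mem hj₁ (mul_mem (z_mem_jordan k y z) hj₂), ?_⟩
    rw [map_add, map_add, map_mul, map_mul, map_mul, mul_add, mul_add, ← mul_assoc e (_ * _),
      ← mul_assoc e (ι z), hexy, hez]
  · -- `(1 - e) x y = 0`
    obtain ⟨j₁, hj₁, j₂, hj₂, rfl⟩ := h.exists_jordan_add_xy_mul hx hy hb
    refine ⟨j₁, hj₁, ?_⟩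
    rw [map_add, map_mul, map_mul, mul_add, ← mul_assoc (1 - e) (_ * _), sub_mul 1 e (_ * _),
      one_mul, hexy, sub_self, zero_mul, add_zero]

end IsSuperJordanPlane

/-! ### Super-simplicity and the descending chain conditions -/

section Chains

variable {k : Type*} [Field k] {A : Type*} [Ring A] [Algebra k A] {𝒜 : ZMod 2 → Submodule k A}
  [GradedAlgebra 𝒜] {e f y : A}

/-- A homogeneous left ideal is determined by which of the two idempotents it contains. -/
theorem left_le_of_idempotent_mem (hef : e + f = 1) (hy : y ∈ 𝒜 1) (hy' : IsUnit y)
    (hQ : ∀ q ∈ 𝒜 0, (Commute e q ∧ (e * q = 0 ∨ ∃ u, u * q = e ∧ q * u = e)) ∧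
      (Commute f q ∧ (f * q = 0 ∨ ∃ u, u * q = f ∧ q * u = f)))
    {I I' : Submodule A A} (hI : I.IsHomogeneous 𝒜) (he : e ∈ I → e ∈ I') (hf : f ∈ I → f ∈ I') :
    I ≤ I' := by
  have even : ∀ q ∈ 𝒜 0, q ∈ I → q ∈ I' := by
    intro q hq hqI
    obtain ⟨⟨ce, de⟩, cf, df⟩ := hQ q hq
    rw [← one_mul q, ← hef, add_mul]
    refine add_mem ?_ ?_
    · rcases de with h0 | ⟨u, hu, -⟩
      · rw [h0]; exact zero_mem _
      · rw [ce.eq]; exact I'.smul_mem q (he (hu ▸ I.smul_mem u hqI))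
    · rcases df with h0 | ⟨u, hu, -⟩
      · rw [h0]; exact zero_mem _
      · rw [cf.eq]; exact I'.smul_mem q (hf (hu ▸ I.smul_mem u hqI))
  intro q hq
  rw [← decompose_zero_add_decompose_one 𝒜 q]
  refine add_mem (even _ (SetLike.coe_mem _) (hI 0 hq)) ?_
  have h1 := even _ (mem_zero_of_mul_mem_one hy (SetLike.coe_mem (DirectSum.decompose 𝒜 q 1)))
    (I.smul_mem y (hI 1 hq))
  obtain ⟨v, rfl⟩ := hy'
  have h2 := I'.smul_mem (↑v⁻¹ : A) h1
  rwa [smul_eq_mul, Units.inv_mul_cancel_left] at h2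

open MulOpposite in
/-- A homogeneous right ideal is determined by which of the two idempotents it contains. -/
theorem right_le_of_idempotent_mem (hef : e + f = 1) (hy : y ∈ 𝒜 1) (hy' : IsUnit y)
    (hQ : ∀ q ∈ 𝒜 0, (Commute e q ∧ (e * q = 0 ∨ ∃ u, u * q = e ∧ q * u = e)) ∧
      (Commute f q ∧ (f * q = 0 ∨ ∃ u, u * q = f ∧ q * u = f)))
    {I I' : Submodule Aᵐᵒᵖ A} (hI : I.IsHomogeneous 𝒜) (he : e ∈ I → e ∈ I')
    (hf : f ∈ I → f ∈ I') : I ≤ I' := by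
  have even : ∀ q ∈ 𝒜 0, q ∈ I → q ∈ I' := by
    intro q hq hqI
    obtain ⟨⟨ce, de⟩, cf, df⟩ := hQ q hq
    rw [← one_mul q, ← hef, add_mul]
    refine add_mem ?_ ?_
    · rcases de with h0 | ⟨u, -, hu⟩
      · rw [h0]; exact zero_mem _
      · exact I'.smul_mem (op q) (he (hu ▸ I.smul_mem (op u) hqI))
    · rcases df with h0 | ⟨u, -, hu⟩
      · rw [h0]; exact zero_mem _
      · exact I'.smul_mem (op q) (hf (hu ▸ I.smul_mem (op u) hqI))
  intro q hq
  rw [← decompose_zero_add_decompose_one 𝒜 q]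
  refine add_mem (even _ (SetLike.coe_mem _) (hI 0 hq)) ?_
  have h1 := even _ (mem_zero_of_mul_mem_one (SetLike.coe_mem (DirectSum.decompose 𝒜 q 1)) hy)
    (I.smul_mem (op y) (hI 1 hq))
  obtain ⟨v, rfl⟩ := hy'
  have h2 := I'.smul_mem (op (↑v⁻¹ : A)) h1
  rwa [op_smul_eq_mul, Units.mul_inv_cancel_right] at h2

theorem exists_forall_imp (p : ℕ → Prop) :
    ∃ N, ∀ n, p N → p n := by
  by_cases hall : ∀ n, p n
  · exact ⟨0, fun n _ => hall n⟩
  · obtain ⟨N, hN⟩ := not_forall.mp hall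
    exact ⟨N, fun n h => absurd h hN⟩

/-- A descending chain becomes stationary if its members are determined by their intersections
with a set of two elements. -/
theorem chain_stationary {R M : Type*} [Semiring R] [AddCommMonoid M] [Module R M] (e f : M)
    {I : ℕ → Submodule R M} (hI : Antitone I)
    (hle : ∀ m n, (e ∈ I m → e ∈ I n) → (f ∈ I m → f ∈ I n) → I m ≤ I n) :
    ∃ N, ∀ n, N ≤ n → I n = I N := by
  obtain ⟨N₁, h₁⟩ := exists_forall_imp fun n => e ∈ I n
  obtain ⟨N₂, h₂⟩ := exists_forall_imp fun n => f ∈ I n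
  refine ⟨max N₁ N₂, fun n hn => le_antisymm (hI hn) (hle _ _ (fun h => ?_) fun h => ?_)⟩
  · exact h₁ n (hI (le_max_left _ _) h)
  · exact h₂ n (hI (le_max_right _ _) h)

/-- There are only four possibilities for a homogeneous one-sided ideal, so chains stop. -/
theorem isSuperArtinian_of_idempotents (hef : e + f = 1) (hy : y ∈ 𝒜 1) (hy' : IsUnit y)
    (hQ : ∀ q ∈ 𝒜 0, (Commute e q ∧ (e * q = 0 ∨ ∃ u, u * q = e ∧ q * u = e)) ∧
      (Commute f q ∧ (f * q = 0 ∨ ∃ u, u * q = f ∧ q * u = f))) :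
    IsSuperArtinian 𝒜 :=
  ⟨fun _ hI hom => chain_stationary e f hI fun m _ =>
      left_le_of_idempotent_mem hef hy hy' hQ (hom m),
    fun _ hI hom => chain_stationary e f hI fun m _ =>
      right_le_of_idempotent_mem hef hy hy' hQ (hom m)⟩

theorem isSuperSimple_of_idempotents [Nontrivial A] (hef : e + f = 1) (hy : y ∈ 𝒜 1)
    (hy' : IsUnit y) (hyef : y * e = f * y)
    (hQ : ∀ q ∈ 𝒜 0, (Commute e q ∧ (e * q = 0 ∨ ∃ u, u * q = e ∧ q * u = e)) ∧
      (Commute f q ∧ (f * q = 0 ∨ ∃ u, u * q = f ∧ q * u = f))) :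
    IsSuperSimple 𝒜 := by
  refine ⟨inferInstance, fun I hI2 hI => ?_⟩
  by_cases hI0 : I = ⊥
  · exact Or.inl hI0
  refine Or.inr ((Ideal.eq_top_iff_one I).mpr ?_)
  -- since `y e = f y` with `y` invertible, the ideal contains both idempotents or none
  have hiff : e ∈ I ↔ f ∈ I := by
    obtain ⟨v, rfl⟩ := hy'
    constructor
    · intro he
      have := I.mul_mem_right (↑v⁻¹ : A) (I.mul_mem_left (v : A) he)
      rwa [hyef, Units.mul_inv_cancel_right] at this
    · intro hf
      have := I.mul_mem_left (↑v⁻¹ : A) (I.mul_mem_right (v : A) hf)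
      rwa [← hyef, Units.inv_mul_cancel_left] at this
  by_cases he : e ∈ I
  · rw [← hef]
    exact add_mem he (hiff.mp he)
  · exact absurd (le_bot_iff.mp (left_le_of_idempotent_mem hef hy hy' hQ hI
      (fun h => absurd h he) fun h => absurd (hiff.mpr h) he)) hI0

end Chains

/-! ### The ring of fractions of the super Jordan plane -/

namespace IsSuperJordanPlane

open SuperJordan

/-- The Ore conditions, and the structure of every ring of fractions, for any algebra presented as
the super Jordan plane and graded so that both generators are odd. -/
theorem fractions {k : Type u} [Field k] {A : Type u} [Ring A] [Algebra k A] {x y z : A}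
    (h : IsSuperJordanPlane k x y z) (ℬ : ZMod 2 → Submodule k A) [GradedAlgebra ℬ]
    (hx : x ∈ ℬ 1) (hy : y ∈ ℬ 1) :
    LeftOreCondition (SetLike.homogeneousSubmonoid ℬ ⊓ nonZeroDivisors A) ∧
    RightOreCondition (SetLike.homogeneousSubmonoid ℬ ⊓ nonZeroDivisors A) ∧
    (∃ (Q : Type u) (_ : Ring Q) (_ : Algebra k Q) (ι : A →ₐ[k] Q),
      IsRightRingOfFractions (SetLike.homogeneousSubmonoid ℬ ⊓ nonZeroDivisors A) ι.toRingHom) ∧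
    (∀ (Q : Type v) [Ring Q] [Algebra k Q] (ι : A →ₐ[k] Q),
      IsRightRingOfFractions (SetLike.homogeneousSubmonoid ℬ ⊓ nonZeroDivisors A) ι.toRingHom →
      ∃ (𝒬 : ZMod 2 → Submodule k Q) (_ : GradedAlgebra 𝒬),
        (∀ i, ∀ b ∈ ℬ i, ι b ∈ 𝒬 i) ∧
        (∃ ι₀ : SetLike.GradeZero.subalgebra ℬ →ₐ[k] SetLike.GradeZero.subalgebra 𝒬,
          (∀ b : SetLike.GradeZero.subalgebra ℬ, (ι₀ b : Q) = ι b) ∧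
          IsRightRingOfFractions (nonZeroDivisors (SetLike.GradeZero.subalgebra ℬ))
            ι₀.toRingHom) ∧
        IsRightRingOfFractions
          ((nonZeroDivisors (SetLike.GradeZero.subalgebra ℬ)).map
            (SetLike.GradeZero.subalgebra ℬ).val.toRingHom) ι.toRingHom ∧
        IsSuperSimple 𝒬 ∧ IsSuperArtinian 𝒬) := by
  refine ⟨h.leftOreCondition hx hy, h.rightOreCondition hx hy, exists_isRightRingOfFractions
    inf_le_right (h.leftOreCondition hx hy) (h.rightOreCondition hx hy), fun Q _ _ ι hS => ?_⟩
  have hι := h.isRightRingOfFractions_jordan hS inf_le_right (h.jordanDenominators_le hx hy)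
  let _ := h.fractionGradedAlgebra hx hy hι
  have hyQ := h.map_mem_fractionPart (ι := ι) hx hy hy
  have hyu := h.isUnit_map hι h.y_mem_nonZeroDivisors
  have := h.nontrivial
  have : Nontrivial Q := (injective_of_fractions hι).nontrivial
  obtain ⟨e, f, hef, hyef, hQ⟩ := h.exists_idempotents hx hy hι
  refine ⟨h.fractionPart (ι := ι) hx hy, inferInstance,
    fun i b hb => h.map_mem_fractionPart hx hy hb, h.exists_even_fractions hx hy hι,
    h.isRightRingOfFractions_of_le hι ?_ ?_,
    isSuperSimple_of_idempotents hef hyQ hyu hyef hQ,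
    isSuperArtinian_of_idempotents hef hyQ hyu hQ⟩
  · rintro _ ⟨s, hs, rfl⟩
    exact h.coe_mem_nonZeroDivisors hy hs
  · intro j hj
    obtain ⟨hl, hr⟩ := mem_nonZeroDivisors_iff.mp hj.2
    refine ⟨⟨j, h.jordan_le_zero hx hy hj.1⟩, mem_nonZeroDivisors_iff.mpr
      ⟨fun a ha => ?_, fun a ha => ?_⟩, rfl⟩
    · exact Subtype.ext (hl _ (congrArg Subtype.val ha))
    · exact Subtype.ext (hr _ (congrArg Subtype.val ha))

end IsSuperJordanPlane

theorem theorem4 {k : Type u} [Field k] (hk : ringChar k ≠ 2) :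
    -- (i) the left and right Ore conditions
    LeftOreCondition (SuperJordan.S k) ∧ RightOreCondition (SuperJordan.S k) ∧
    -- the ring of fractions `Q = B S⁻¹` exists
    (∃ (Q : Type u) (_ : Ring Q) (_ : Algebra k Q) (ι : SuperJordan.Plane k →ₐ[k] Q),
      IsRightRingOfFractions (SuperJordan.S k) ι.toRingHom) ∧
    -- and every model `Q` of it has the following properties
    (∀ (Q : Type v) [Ring Q] [Algebra k Q] (ι : SuperJordan.Plane k →ₐ[k] Q),
      IsRightRingOfFractions (SuperJordan.S k) ι.toRingHom →
      -- (ii) `Q` is a superalgebra and `B → Q` preserves parity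
      ∃ (𝒬 : ZMod 2 → Submodule k Q) (_ : GradedAlgebra 𝒬),
        (∀ i, ∀ b ∈ SuperJordan.parityPart k i, ι b ∈ 𝒬 i) ∧
        -- `Q_0 = B_0 S_0⁻¹`
        (∃ ι₀ : SuperJordan.evenPart k →ₐ[k] SetLike.GradeZero.subalgebra 𝒬,
          (∀ b : SuperJordan.evenPart k, (ι₀ b : Q) = ι b) ∧
          IsRightRingOfFractions (R := SuperJordan.evenPart k)
            (Q := SetLike.GradeZero.subalgebra 𝒬) (SuperJordan.S₀ k) ι₀.toRingHom) ∧
        -- `Q = B S_0⁻¹`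
        IsRightRingOfFractions
          ((SuperJordan.S₀ k).map (SuperJordan.evenPart k).val.toRingHom) ι.toRingHom ∧
        -- (iii) `Q` is super-simple and super-artinian
        IsSuperSimple 𝒬 ∧ IsSuperArtinian 𝒬) :=
  (SuperJordan.isSuperJordanPlane k).fractions (SuperJordan.parityPart k) (SuperJordan.x_mem k)
    (SuperJordan.y_mem k)
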